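/- Conventions. A topological groupoid $\mathsf G$ has spaces of objects $\mathsf G_0$ and arrows $\mathsf G_1$ and continuous structure maps $s,t,e,i,m$; the product $a\cdot b$ means "first $a$, then $b$". A morphism $F:\mathsf H\to\mathsf G$ (a pair of continuous maps $F_0,F_1$ compatible with the structure maps) is \emph{Morita} if $\mathsf H_1\to(\mathsf H_0\times\mathsf H_0)\times_{\mathsf G_0\times\mathsf G_0}\mathsf G_1$, $a\mapsto((s(a),t(a)),F_1(a))$, is a homeomorphism and $s\pi_2:\mathsf H_0\,{}_{F_0}\!\times_{t}\mathsf G_1\to\mathsf G_0$ is an open surjection; two topological groupoids are \emph{Morita equivalent} if some topological groupoid admits Morita morphisms to both. An \emph{orbifold groupoid} is a proper étale smooth groupoid: $\mathsf G_0,\mathsf G_1$ are Hausdorff smooth manifolds of some dimension $n$ (not necessarily second countable), $s,t$ are local diffeomorphisms, and $(s,t):\mathsf G_1\to\mathsf G_0\times\mathsf G_0$ is proper. Loop groupoid. An admissible cover $W$ is given by a nonempty finite set of points of $S^1=\mathbb R/\mathbb Z$ and $\epsilon>0$ such that the intervals $W_a=(a-\epsilon,a^++\epsilon)\subset\mathbb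 R$ have empty triple intersections; here $a$ runs over the set of all lifts to $\mathbb R$ of the chosen points and $a^+$ is the next lift after $a$. Let $\mathsf S^1_W$ be the groupoid with objects $\bigsqcup_a W_a$ and arrows $\bigl(\bigsqcup_{a,b}W_a\cap W_b\bigr)\times\mathbb Z$, where $((x,a,b),l)$ goes from $(x,a)$ to $(x+l,b+l)$. $\mathsf{LG}(W)$ is the groupoid whose objects are the morphisms $\Psi:\mathsf S^1_W\to\mathsf G$ and whose arrows $\Psi\to\Phi$ are the continuous maps $\Lambda:(\mathsf S^1_W)_1\to\mathsf G_1$ over $(\Psi_0,\Phi_0)$ with $\Lambda(r)=\Psi_1(r)\cdot\Lambda(et(r))=\Lambda(es(r))\cdot\Phi_1(r)$, with compact-open topologies. A cover $W'$ refines $W$ if it has at least the points of $W$ and $\epsilon'\le\epsilon$; then $W'_{a'}\subset W_a$ for $a$ the largest lift for $W$ with $a\le a'$, which induces $\mathsf S^1_{W'}\to\mathsf S^1_W$ and $\mathsf{LG}(W)\to\mathsf{LG}(W')$. The \emph{loop groupoid} is $\mathsf{LG}=\varinjlim_W\mathsf{LG}(W)$ over all admissible covers, with the colimit topologies. Each $z\in\mathbb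 R$ acts on $\mathsf{LG}$ by sending $\Psi$ on $W$ to $\Psi^z$ on the cover translated by $z$, $\Psi^z_1((x,a,b),l)=\Psi_1((x-z,a-z,b-z),l)$, and similarly on arrows. $\mathsf{LG}^{\mathbb R}$ is the subgroupoid of objects and arrows fixed by all $z\in\mathbb R$, with the subspace topologies. Twisted sectors. For $x\in\mathsf G_0$ let $G_x$ be its isotropy group. An orbifold chart at $x$ is a connected open neighbourhood $V$ of $x$ in $\mathsf G_0$ with a right action of $G_x$ and an isomorphism of topological groupoids, identical on objects, of the action groupoid $V\rtimes G_x$ with the restriction $\mathsf G|_V$, taking $(x,g)$ to $g$. An orbifold atlas consists, for each point $p$ of the orbit space, of a representative $x_p\in\mathsf G_0$, an orbifold chart $(V_p,G_p)$ at $x_p$ with $G_p=G_{x_p}$, and a representative $g$ of each conjugacy class $(g)$ of $G_p$. The (Kawasaki/Ruan) twisted-sector groupoid $\widetilde{\Sigma_1\mathsf G}$ has as objects the disjoint union $\bigsqcup_{(p,(g))}V_p^g$ of fixed-point sets over all $p$ and all conjugacy classes $(g)\subset G_p$; its arrows from $y\in V_p^g$ to $y'\in V_q^h$ are the arrows $\alpha:y\to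 y'$ of $\mathsf G$ with $g_y\cdot\alpha=\alpha\cdot h_{y'}$, where $g_y\in\mathsf G_1$ is the arrow $y\to y$ corresponding to $(y,g)$ (topologized as a subspace of the product of objects, $\mathsf G_1$ and objects). Its restriction to $V_p^g$ is the action groupoid of the centralizer $C(g)$ on $V_p^g$. Theorem. Let $\mathsf G$ be an orbifold groupoid. Then $\mathsf G$ has an orbifold atlas, and for every orbifold atlas the fixed loop groupoid $\mathsf{LG}^{\mathbb R}$ and the twisted-sector groupoid $\widetilde{\Sigma_1\mathsf G}$ are topological groupoids that are Morita equivalent. -/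

import Mathlib

open scoped Manifold ContDiff

universe u v w

/-- A groupoid (small category with all morphisms invertible) presented by its set of objects, its
set of arrows and its structure maps, together with a topology on objects and on arrows. No
compatibility is required here, see `TGpd.IsTopological`. Composition is written in diagrammatic
order: `comp a b` is "first `a`, then `b`", and makes sense when the target of `a` is the source
of `b`. -/
structure TGpd where
  Obj : Type u
  Arr : Type u
  [topObj : TopologicalSpace Obj]
  [topArr : TopologicalSpace Arr]
  src : Arr → Obj
  tgt : Arr → Obj
  unit : Obj → Arr
  inv : Arr → Arr
  comp : (a b : Arr) → tgt a = src b → Arr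
  src_unit : ∀ x, src (unit x) = x
  tgt_unit : ∀ x, tgt (unit x) = x
  src_inv : ∀ a, src (inv a) = tgt a
  tgt_inv : ∀ a, tgt (inv a) = src a
  src_comp : ∀ a b h, src (comp a b h) = src a
  tgt_comp : ∀ a b h, tgt (comp a b h) = tgt b
  unit_comp : ∀ a, comp (unit (src a)) a (tgt_unit _) = a
  comp_unit : ∀ a, comp a (unit (tgt a)) (src_unit _).symm = a
  inv_comp : ∀ a, comp (inv a) a (tgt_inv a) = unit (tgt a)
  comp_inv : ∀ a, comp a (inv a) (src_inv a).symm = unit (src a)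
  assoc : ∀ a b c hab hbc,
    comp (comp a b hab) c ((tgt_comp a b hab).trans hbc) =
      comp a (comp b c hbc) (hab.trans (src_comp b c hbc).symm)

attribute [instance] TGpd.topObj TGpd.topArr

namespace TGpd

/-- A topological groupoid: all the structure maps are continuous. -/
class IsTopological (G : TGpd.{u}) : Prop where
  continuous_src : Continuous G.src
  continuous_tgt : Continuous G.tgt
  continuous_unit : Continuous G.unit
  continuous_inv : Continuous G.inv
  continuous_comp :
    Continuous fun p : {p : G.Arr × G.Arr // G.tgt p.1 = G.src p.2} => G.comp p.1.1 p.1.2 p.2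

attribute [simp] src_unit tgt_unit src_inv tgt_inv src_comp tgt_comp

section Algebra

variable (G : TGpd.{u})

theorem comp_congr {a a' b b' : G.Arr} (ha : a = a') (hb : b = b') (h : G.tgt a = G.src b) :
    G.comp a b h = G.comp a' b' (by rw [← ha, ← hb, h]) := by
  subst ha; subst hb; rfl

theorem unit_comp_of {x : G.Obj} {a : G.Arr} (h : G.tgt (G.unit x) = G.src a) :
    G.comp (G.unit x) a h = a := by
  have hx : x = G.src a := by rw [← h, G.tgt_unit]
  subst hx
  exact G.unit_comp a

theorem comp_unit_of {x : G.Obj} {a : G.Arr} (h : G.tgt a = G.src (G.unit x)) :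
    G.comp a (G.unit x) h = a := by
  have hx : x = G.tgt a := by rw [h, G.src_unit]
  subst hx
  exact G.comp_unit a

theorem inv_comp_cancel {a b : G.Arr} (h : G.tgt a = G.src b)
    (h' : G.tgt (G.inv a) = G.src (G.comp a b h)) : G.comp (G.inv a) (G.comp a b h) h' = b := by
  rw [← G.assoc _ _ _ (G.tgt_inv a) h]
  rw [G.comp_congr (G.inv_comp a) rfl]
  exact G.unit_comp_of _

theorem comp_inv_cancel {a b : G.Arr} (h : G.tgt (G.inv a) = G.src b)
    (h' : G.tgt a = G.src (G.comp (G.inv a) b h)) : G.comp a (G.comp (G.inv a) b h) h' = b := by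
  rw [← G.assoc _ _ _ (G.src_inv a).symm h]
  rw [G.comp_congr (G.comp_inv a) rfl]
  exact G.unit_comp_of _

theorem continuous_comp_of [G.IsTopological] {X : Type*} [TopologicalSpace X] {a b : X → G.Arr}
    (ha : Continuous a) (hb : Continuous b) (h : ∀ x, G.tgt (a x) = G.src (b x)) :
    Continuous fun x => G.comp (a x) (b x) (h x) :=
  (IsTopological.continuous_comp (G := G)).comp ((ha.prodMk hb).subtype_mk h)

end Algebra

/-- A morphism of groupoids with topologies: continuous maps on objects and arrows commuting with
the structure maps (compatibility with inverses is automatic). -/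
structure Hom (H : TGpd.{v}) (G : TGpd.{u}) where
  obj : C(H.Obj, G.Obj)
  arr : C(H.Arr, G.Arr)
  src_arr : ∀ a, G.src (arr a) = obj (H.src a)
  tgt_arr : ∀ a, G.tgt (arr a) = obj (H.tgt a)
  arr_unit : ∀ x, arr (H.unit x) = G.unit (obj x)
  arr_comp : ∀ a b h, arr (H.comp a b h) =
    G.comp (arr a) (arr b) ((tgt_arr a).trans ((congrArg obj h).trans (src_arr b).symm))

namespace Hom

attribute [simp] src_arr tgt_arr arr_unit

theorem ext' {H : TGpd.{v}} {G : TGpd.{u}} {F F' : Hom H G} (h0 : ∀ x, F.obj x = F'.obj x)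
    (h1 : ∀ a, F.arr a = F'.arr a) : F = F' := by
  cases F; cases F'
  congr
  · exact ContinuousMap.ext h0
  · exact ContinuousMap.ext h1

theorem arr_inv {H : TGpd.{v}} {G : TGpd.{u}} (F : Hom H G) (a : H.Arr) :
    F.arr (H.inv a) = G.inv (F.arr a) := by
  have h1 := F.arr_comp _ _ (H.tgt_inv a)
  rw [H.inv_comp, F.arr_unit] at h1
  have h2 : G.tgt (F.arr (H.inv a)) = G.src (F.arr a) := by simp
  have h3 : G.comp (G.comp (F.arr (H.inv a)) (F.arr a) h2) (G.inv (F.arr a)) (by simp) =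
      F.arr (H.inv a) := by
    rw [G.assoc _ _ _ h2 (by simp), G.comp_congr rfl (G.comp_inv _)]
    exact G.comp_unit_of _
  rw [← h3, G.comp_congr h1.symm rfl]
  exact G.unit_comp_of _

/-- Composition of morphisms. -/
def trans {K : TGpd.{w}} {H : TGpd.{v}} {G : TGpd.{u}} (E : Hom K H) (F : Hom H G) : Hom K G where
  obj := F.obj.comp E.obj
  arr := F.arr.comp E.arr
  src_arr a := by simp
  tgt_arr a := by simp
  arr_unit x := by simp
  arr_comp a b h := by
    simp only [ContinuousMap.comp_apply, E.arr_comp, F.arr_comp]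

/-- A morphism `F : H → G` is Morita if the square formed by `(s, t)` on `H` and on `G` is
cartesian in topological spaces, and if the map `s ∘ π₂ : H₀ ×_{F₀, t} G₁ → G₀` is an open
surjection. -/
structure IsMorita {H : TGpd.{v}} {G : TGpd.{u}} (F : Hom H G) : Prop where
  cartesian : IsHomeomorph fun a : H.Arr =>
    (⟨((H.src a, H.tgt a), F.arr a), F.src_arr a, F.tgt_arr a⟩ :
      {p : (H.Obj × H.Obj) × G.Arr // G.src p.2 = F.obj p.1.1 ∧ G.tgt p.2 = F.obj p.1.2})
  surjective : Function.Surjective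
    fun p : {p : H.Obj × G.Arr // F.obj p.1 = G.tgt p.2} => G.src p.1.2
  isOpenMap : IsOpenMap
    fun p : {p : H.Obj × G.Arr // F.obj p.1 = G.tgt p.2} => G.src p.1.2

end Hom

/-- Two topological groupoids are Morita equivalent if some topological groupoid maps to both of
them by Morita morphisms. (That `G` and `H` are topological groupoids is part of the assertion.) -/
def MoritaEquivalent (G H : TGpd.{u}) : Prop :=
  G.IsTopological ∧ H.IsTopological ∧
    ∃ K : TGpd.{u}, K.IsTopological ∧
      ∃ (E : Hom K G) (F : Hom K H), E.IsMorita ∧ F.IsMorita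

/-! ### The groupoid of morphisms between two groupoids -/

/-- An arrow from `dom` to `cod` between two morphisms `K → G`: a continuous map
`Λ : K₁ → G₁` lying over `(dom₀, cod₀)` with
`Λ(r) = dom₁(r) · Λ(e t r) = Λ(e s r) · cod₁(r)`. -/
structure MapArr (K : TGpd.{v}) (G : TGpd.{u}) where
  dom : Hom K G
  cod : Hom K G
  app : C(K.Arr, G.Arr)
  src_app : ∀ r, G.src (app r) = dom.obj (K.src r)
  tgt_app : ∀ r, G.tgt (app r) = cod.obj (K.tgt r)
  app_eq_left : ∀ r, app r = G.comp (dom.arr r) (app (K.unit (K.tgt r)))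
    (by rw [dom.tgt_arr, src_app, K.src_unit])
  app_eq_right : ∀ r, app r = G.comp (app (K.unit (K.src r))) (cod.arr r)
    (by rw [cod.src_arr, tgt_app, K.tgt_unit])

namespace MapArr

variable {K : TGpd.{v}} {G : TGpd.{u}}

attribute [simp] src_app tgt_app

theorem ext' {L M : MapArr K G} (hd : L.dom = M.dom) (hc : L.cod = M.cod)
    (ha : ∀ r, L.app r = M.app r) : L = M := by
  cases L; cases M
  simp only at hd hc ha
  subst hd; subst hc
  congr
  exact ContinuousMap.ext ha

/-- Two arrows agree as soon as their sources, targets and restrictions to units agree. -/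
theorem ext_unit {L M : MapArr K G} (hd : L.dom = M.dom) (hc : L.cod = M.cod)
    (ha : ∀ x, L.app (K.unit x) = M.app (K.unit x)) : L = M := by
  refine ext' hd hc fun r => ?_
  rw [L.app_eq_right, M.app_eq_right]
  exact G.comp_congr (ha _) (by rw [hc]) _

/-- Build an arrow from its restriction `o` to units: a continuous natural transformation. -/
def ofUnits [K.IsTopological] [G.IsTopological] (dom cod : Hom K G) (o : K.Obj → G.Arr)
    (ho : Continuous o) (hs : ∀ x, G.src (o x) = dom.obj x) (ht : ∀ x, G.tgt (o x) = cod.obj x)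
    (nat : ∀ r, G.comp (dom.arr r) (o (K.tgt r)) (by rw [hs, dom.tgt_arr]) =
      G.comp (o (K.src r)) (cod.arr r) (by rw [ht, cod.src_arr])) : MapArr K G where
  dom := dom
  cod := cod
  app := ⟨fun r => G.comp (o (K.src r)) (cod.arr r) (by rw [ht, cod.src_arr]),
    G.continuous_comp_of (ho.comp IsTopological.continuous_src) cod.arr.continuous
      fun r => by simp [ht]⟩
  src_app r := by simp [hs]
  tgt_app r := by simp
  app_eq_left r := by
    simp only [ContinuousMap.coe_mk]
    rw [← nat r]
    refine G.comp_congr rfl ?_ _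
    rw [G.comp_congr (congrArg o (K.src_unit _)) (cod.arr_unit _)]
    exact (G.comp_unit_of _).symm
  app_eq_right r := by
    simp only [ContinuousMap.coe_mk]
    refine G.comp_congr ?_ rfl _
    rw [G.comp_congr (congrArg o (K.src_unit _)) (cod.arr_unit _)]
    exact (G.comp_unit_of _).symm

theorem ofUnits_app_unit [K.IsTopological] [G.IsTopological] (dom cod : Hom K G)
    (o : K.Obj → G.Arr) (ho : Continuous o) (hs ht nat) (x : K.Obj) :
    (ofUnits dom cod o ho hs ht nat).app (K.unit x) = o x := by
  change G.comp (o (K.src (K.unit x))) (cod.arr (K.unit x)) (by simp [ht]) = _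
  rw [G.comp_congr (congrArg o (K.src_unit _)) (cod.arr_unit _)]
  exact G.comp_unit_of _

theorem naturality (L : MapArr K G) (r : K.Arr) :
    G.comp (L.dom.arr r) (L.app (K.unit (K.tgt r))) (by simp) =
      G.comp (L.app (K.unit (K.src r))) (L.cod.arr r) (by simp) := by
  rw [← L.app_eq_left, ← L.app_eq_right]

/-- The unit arrow at `F`, that is `Λ = F₁`. -/
def one (F : Hom K G) : MapArr K G where
  dom := F
  cod := F
  app := F.arr
  src_app r := by simp
  tgt_app r := by simp
  app_eq_left r := by
    rw [G.comp_congr rfl (F.arr_unit _)]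
    exact (G.comp_unit_of _).symm
  app_eq_right r := by
    rw [G.comp_congr (F.arr_unit _) rfl]
    exact (G.unit_comp_of _).symm

/-- Pointwise composition: `(L · M)(r) = L(e s r) · M(e s r) · cod₁(r)`. -/
def mul [K.IsTopological] [G.IsTopological] (L M : MapArr K G) (h : L.cod = M.dom) :
    MapArr K G :=
  ofUnits L.dom M.cod
    (fun x => G.comp (L.app (K.unit x)) (M.app (K.unit x)) (by simp [h]))
    (G.continuous_comp_of (L.app.continuous.comp IsTopological.continuous_unit)
      (M.app.continuous.comp IsTopological.continuous_unit) fun x => by simp [h])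
    (fun x => by simp) (fun x => by simp)
    (fun r => by
      have hL := L.naturality r
      have hM := M.naturality r
      rw [← G.assoc _ _ _ (by simp) (by simp [h]), G.comp_congr hL rfl,
        G.assoc _ _ _ (by simp) (by simp [h])]
      rw [G.assoc _ _ _ (by simp [h]) (by simp)]
      refine G.comp_congr rfl ?_ _
      rw [← hM]
      exact G.comp_congr (by rw [h]) rfl _)

/-- Pointwise inverse. -/
def symm [K.IsTopological] [G.IsTopological] (L : MapArr K G) : MapArr K G :=
  ofUnits L.cod L.dom (fun x => G.inv (L.app (K.unit x)))
    (IsTopological.continuous_inv.comp (L.app.continuous.comp IsTopological.continuous_unit))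
    (fun x => by simp) (fun x => by simp)
    (fun r => by
      have hL := L.naturality r
      have h1 : G.comp (G.inv (L.app (K.unit (K.src r))))
          (G.comp (L.dom.arr r) (L.app (K.unit (K.tgt r))) (by simp)) (by simp) = L.cod.arr r := by
        rw [G.comp_congr rfl hL]
        exact G.inv_comp_cancel _ _
      rw [G.comp_congr h1.symm rfl, G.assoc _ _ _ (by simp) (by simp)]
      refine G.comp_congr rfl ?_ _
      rw [G.assoc _ _ _ (by simp) (by simp), G.comp_congr rfl (G.comp_inv _)]
      exact G.comp_unit_of _)

theorem mul_app_unit [K.IsTopological] [G.IsTopological] (L M : MapArr K G) (h : L.cod = M.dom)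
    (x : K.Obj) : (L.mul M h).app (K.unit x) =
      G.comp (L.app (K.unit x)) (M.app (K.unit x)) (by simp [h]) :=
  ofUnits_app_unit _ _ _ _ _ _ _ x

theorem symm_app_unit [K.IsTopological] [G.IsTopological] (L : MapArr K G) (x : K.Obj) :
    L.symm.app (K.unit x) = G.inv (L.app (K.unit x)) :=
  ofUnits_app_unit _ _ _ _ _ _ _ x

theorem one_app_unit (F : Hom K G) (x : K.Obj) : (one F).app (K.unit x) = G.unit (F.obj x) :=
  F.arr_unit x

theorem one_mul' [K.IsTopological] [G.IsTopological] (L : MapArr K G) (h) :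
    (one L.dom).mul L h = L := by
  refine ext_unit rfl rfl fun x => ?_
  rw [mul_app_unit, G.comp_congr (one_app_unit L.dom x) rfl]
  exact G.unit_comp_of _

theorem mul_one' [K.IsTopological] [G.IsTopological] (L : MapArr K G) (h) :
    L.mul (one L.cod) h = L := by
  refine ext_unit rfl rfl fun x => ?_
  rw [mul_app_unit, G.comp_congr rfl (one_app_unit L.cod x)]
  exact G.comp_unit_of _

theorem symm_mul [K.IsTopological] [G.IsTopological] (L : MapArr K G) (h) :
    L.symm.mul L h = one L.cod := by
  refine ext_unit rfl rfl fun x => ?_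
  rw [mul_app_unit, G.comp_congr (L.symm_app_unit x) rfl, G.inv_comp, one_app_unit, L.tgt_app,
    K.tgt_unit]

theorem mul_symm [K.IsTopological] [G.IsTopological] (L : MapArr K G) (h) :
    L.mul L.symm h = one L.dom := by
  refine ext_unit rfl rfl fun x => ?_
  rw [mul_app_unit, G.comp_congr rfl (L.symm_app_unit x), G.comp_inv, one_app_unit, L.src_app,
    K.src_unit]

theorem mul_assoc' [K.IsTopological] [G.IsTopological] (L M N : MapArr K G) (h h' h1 h2) :
    (L.mul M h).mul N h1 = L.mul (M.mul N h') h2 := by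
  refine ext_unit rfl rfl fun x => ?_
  refine (mul_app_unit _ _ _ x).trans (Eq.trans ?_ (mul_app_unit _ _ _ x).symm)
  refine (G.comp_congr (mul_app_unit L M h x) rfl _).trans ?_
  refine Eq.trans ?_ (G.comp_congr rfl (mul_app_unit M N h' x) _).symm
  exact G.assoc _ _ _ _ _

end MapArr

/-- The compact-open topology on morphisms `F = (F₀, F₁)`. -/
instance (K : TGpd.{v}) (G : TGpd.{u}) : TopologicalSpace (Hom K G) :=
  TopologicalSpace.induced (fun F => (F.obj, F.arr)) inferInstance

/-- The compact-open topology on arrows `Λ`, each of which is determined by the pair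
`(dom₁, Λ ∘ e)`. -/
instance (K : TGpd.{v}) (G : TGpd.{u}) [K.IsTopological] : TopologicalSpace (MapArr K G) :=
  TopologicalSpace.induced
    (fun L => (L.dom.arr, L.app.comp ⟨K.unit, IsTopological.continuous_unit⟩)) inferInstance

/-- The groupoid of morphisms `K → G` and arrows between them, with compact-open topologies. -/
def mapGpd (K : TGpd.{0}) (G : TGpd.{u}) [K.IsTopological] [G.IsTopological] : TGpd.{u} where
  Obj := Hom K G
  Arr := MapArr K G
  src := MapArr.dom
  tgt := MapArr.cod
  unit := MapArr.one
  inv := MapArr.symm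
  comp := MapArr.mul
  src_unit _ := rfl
  tgt_unit _ := rfl
  src_inv _ := rfl
  tgt_inv _ := rfl
  src_comp _ _ _ := rfl
  tgt_comp _ _ _ := rfl
  unit_comp L := L.one_mul' _
  comp_unit L := L.mul_one' _
  inv_comp L := L.symm_mul _
  comp_inv L := L.mul_symm _
  assoc L M N _ _ := L.mul_assoc' M N _ _ _ _

section Precomp

variable {K K' : TGpd.{0}} {G : TGpd.{u}}

/-- Precomposition of an arrow between morphisms with a morphism `E : K' → K`. -/
def MapArr.precomp (E : Hom K' K) (L : MapArr K G) : MapArr K' G where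
  dom := E.trans L.dom
  cod := E.trans L.cod
  app := L.app.comp E.arr
  src_app r := by simp [Hom.trans]
  tgt_app r := by simp [Hom.trans]
  app_eq_left r := by
    simp only [ContinuousMap.comp_apply]
    rw [L.app_eq_left]
    exact G.comp_congr rfl (by rw [E.arr_unit, E.tgt_arr]) _
  app_eq_right r := by
    simp only [ContinuousMap.comp_apply]
    rw [L.app_eq_right]
    exact G.comp_congr (by rw [E.arr_unit, E.src_arr]) rfl _

theorem Hom.continuous_pair (K : TGpd.{v}) (G : TGpd.{u}) :
    Continuous fun F : Hom K G => (F.obj, F.arr) :=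
  continuous_induced_dom

theorem MapArr.continuous_pair (K : TGpd.{v}) (G : TGpd.{u}) [K.IsTopological] :
    Continuous fun L : MapArr K G =>
      (L.dom.arr, L.app.comp ⟨K.unit, IsTopological.continuous_unit⟩) :=
  continuous_induced_dom

theorem Hom.continuous_trans (E : Hom K' K) :
    Continuous fun F : Hom K G => E.trans F := by
  refine continuous_induced_rng.2 (Continuous.prodMk ?_ ?_)
  · exact (ContinuousMap.continuous_precomp E.obj).comp
      (continuous_fst.comp (Hom.continuous_pair K G))
  · exact (ContinuousMap.continuous_precomp E.arr).comp
      (continuous_snd.comp (Hom.continuous_pair K G))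

theorem MapArr.continuous_precomp [K.IsTopological] [K'.IsTopological] (E : Hom K' K) :
    Continuous fun L : MapArr K G => L.precomp E := by
  refine continuous_induced_rng.2 (Continuous.prodMk ?_ ?_)
  · exact (ContinuousMap.continuous_precomp E.arr).comp
      (continuous_fst.comp (MapArr.continuous_pair K G))
  · have : ∀ L : MapArr K G, (L.precomp E).app.comp ⟨K'.unit, IsTopological.continuous_unit⟩ =
        (L.app.comp ⟨K.unit, IsTopological.continuous_unit⟩).comp E.obj := by
      intro L
      ext x
      simp [MapArr.precomp]
    simp only [this]
    exact (ContinuousMap.continuous_precomp E.obj).comp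
      (continuous_snd.comp (MapArr.continuous_pair K G))

theorem MapArr.precomp_mul [K.IsTopological] [K'.IsTopological] [G.IsTopological] (E : Hom K' K)
    (L M : MapArr K G) (h) (h') : (L.mul M h).precomp E = (L.precomp E).mul (M.precomp E) h' := by
  refine MapArr.ext_unit rfl rfl fun x => ?_
  rw [MapArr.mul_app_unit]
  change (L.mul M h).app (E.arr (K'.unit x)) = _
  rw [E.arr_unit, MapArr.mul_app_unit]
  exact G.comp_congr (congrArg L.app (E.arr_unit x).symm) (congrArg M.app (E.arr_unit x).symm) _

/-- A morphism `E : K' → K` induces a morphism of mapping groupoids by precomposition. -/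
def precomp [K.IsTopological] [K'.IsTopological] (E : Hom K' K) (G : TGpd.{u})
    [G.IsTopological] : Hom (mapGpd K G) (mapGpd K' G) where
  obj := ⟨fun F : Hom K G => E.trans F, Hom.continuous_trans E⟩
  arr := ⟨fun L : MapArr K G => L.precomp E, MapArr.continuous_precomp E⟩
  src_arr _ := rfl
  tgt_arr _ := rfl
  arr_unit _ := rfl
  arr_comp L M h := MapArr.precomp_mul E L M h (congrArg E.trans h)

end Precomp

/-! ### Colimits of directed systems of groupoids -/

/-- A functor from a preorder to groupoids with topologies. -/
structure DirSystem (I : Type) [Preorder I] where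
  gpd : I → TGpd.{u}
  map : ∀ i j, i ≤ j → Hom (gpd i) (gpd j)
  obj_self : ∀ i x, (map i i le_rfl).obj x = x
  arr_self : ∀ i a, (map i i le_rfl).arr a = a
  obj_map : ∀ i j k (hij : i ≤ j) (hjk : j ≤ k) x,
    (map j k hjk).obj ((map i j hij).obj x) = (map i k (hij.trans hjk)).obj x
  arr_map : ∀ i j k (hij : i ≤ j) (hjk : j ≤ k) a,
    (map j k hjk).arr ((map i j hij).arr a) = (map i k (hij.trans hjk)).arr a

namespace DirSystem

variable {I : Type} [Preorder I] (S : DirSystem.{u} I)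

instance : DirectedSystem (fun i => (S.gpd i).Obj) (fun i j h => (S.map i j h).obj) where
  map_self _ x := S.obj_self _ x
  map_map _ _ _ hij hjk x := S.obj_map _ _ _ hij hjk x

instance : DirectedSystem (fun i => (S.gpd i).Arr) (fun i j h => (S.map i j h).arr) where
  map_self _ x := S.arr_self _ x
  map_map _ _ _ hij hjk x := S.arr_map _ _ _ hij hjk x

variable [IsDirectedOrder I]

/-- The space of objects of the colimit: the colimit of the spaces of objects (its topology is the
quotient topology of the disjoint union). -/
abbrev ColimObj : Type u :=
  DirectLimit (fun i => (S.gpd i).Obj) (fun i j h => (S.map i j h).obj)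

/-- The space of arrows of the colimit: the colimit of the spaces of arrows. -/
abbrev ColimArr : Type u :=
  DirectLimit (fun i => (S.gpd i).Arr) (fun i j h => (S.map i j h).arr)

/-- The class in the colimit of an object of one of the groupoids of the system. -/
abbrev mkObj (i : I) (x : (S.gpd i).Obj) : S.ColimObj := Quotient.mk _ ⟨i, x⟩

/-- The class in the colimit of an arrow of one of the groupoids of the system. -/
abbrev mkArr (i : I) (a : (S.gpd i).Arr) : S.ColimArr := Quotient.mk _ ⟨i, a⟩

theorem mkObj_map (i j : I) (h : i ≤ j) (x : (S.gpd i).Obj) :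
    S.mkObj j ((S.map i j h).obj x) = S.mkObj i x :=
  DirectLimit.mk_apply (F := fun i => (S.gpd i).Obj) (f := fun i j h => (S.map i j h).obj) i j x h

theorem mkArr_map (i j : I) (h : i ≤ j) (a : (S.gpd i).Arr) :
    S.mkArr j ((S.map i j h).arr a) = S.mkArr i a :=
  DirectLimit.mk_apply (F := fun i => (S.gpd i).Arr) (f := fun i j h => (S.map i j h).arr) i j a h

theorem mkObj_eq_iff {i j : I} {x : (S.gpd i).Obj} {y : (S.gpd j).Obj} :
    S.mkObj i x = S.mkObj j y ↔
      ∃ (k : I) (hi : i ≤ k) (hj : j ≤ k), (S.map i k hi).obj x = (S.map j k hj).obj y :=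
  Quotient.eq

theorem mkArr_eq_iff {i j : I} {x : (S.gpd i).Arr} {y : (S.gpd j).Arr} :
    S.mkArr i x = S.mkArr j y ↔
      ∃ (k : I) (hi : i ≤ k) (hj : j ≤ k), (S.map i k hi).arr x = (S.map j k hj).arr y :=
  Quotient.eq

/-- Source map of the colimit. -/
def colimSrc : S.ColimArr → S.ColimObj :=
  DirectLimit.map _ _ (fun i => (S.gpd i).src) fun i j h a => ((S.map i j h).src_arr a).symm

/-- Target map of the colimit. -/
def colimTgt : S.ColimArr → S.ColimObj :=
  DirectLimit.map _ _ (fun i => (S.gpd i).tgt) fun i j h a => ((S.map i j h).tgt_arr a).symm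

theorem colimSrc_mk {i : I} (a : (S.gpd i).Arr) :
    S.colimSrc (S.mkArr i a) = S.mkObj i ((S.gpd i).src a) := rfl

theorem colimTgt_mk {i : I} (a : (S.gpd i).Arr) :
    S.colimTgt (S.mkArr i a) = S.mkObj i ((S.gpd i).tgt a) := rfl

/-- Unit map of the colimit. -/
def colimUnit : S.ColimObj → S.ColimArr :=
  DirectLimit.map _ _ (fun i => (S.gpd i).unit) fun i j h x => (S.map i j h).arr_unit x

/-- Inversion of the colimit. -/
def colimInv : S.ColimArr → S.ColimArr :=
  DirectLimit.map _ _ (fun i => (S.gpd i).inv) fun i j h a => (S.map i j h).arr_inv a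

/-- Composable arrows of the colimit are represented by composable arrows at some stage. -/
theorem exists_composable (a b : S.ColimArr) (h : S.colimTgt a = S.colimSrc b) :
    ∃ p : Σ i, {p : (S.gpd i).Arr × (S.gpd i).Arr // (S.gpd i).tgt p.1 = (S.gpd i).src p.2},
      S.mkArr p.1 p.2.1.1 = a ∧ S.mkArr p.1 p.2.1.2 = b := by
  obtain ⟨i, x, y, rfl, rfl⟩ := DirectLimit.exists_eq_mk₂ _ a b
  obtain ⟨k, hi, hj, e⟩ := S.mkObj_eq_iff.1 h
  refine ⟨⟨k, ⟨((S.map i k hi).arr x, (S.map i k hi).arr y), ?_⟩⟩, S.mkArr_map _ _ _ _,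
    S.mkArr_map _ _ _ _⟩
  rw [Hom.tgt_arr, Hom.src_arr]
  exact e

/-- Composition in the colimit: compose representatives at some stage. -/
noncomputable def colimComp (a b : S.ColimArr) (h : S.colimTgt a = S.colimSrc b) : S.ColimArr :=
  let p := (S.exists_composable a b h).choose
  S.mkArr p.1 ((S.gpd p.1).comp p.2.1.1 p.2.1.2 p.2.2)

theorem mkArr_comp_congr {i j : I} {a b : (S.gpd i).Arr} {a' b' : (S.gpd j).Arr}
    (h : (S.gpd i).tgt a = (S.gpd i).src b) (h' : (S.gpd j).tgt a' = (S.gpd j).src b')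
    (ha : S.mkArr i a = S.mkArr j a') (hb : S.mkArr i b = S.mkArr j b') :
    S.mkArr i ((S.gpd i).comp a b h) = S.mkArr j ((S.gpd j).comp a' b' h') := by
  obtain ⟨k, hi, hj, e⟩ := S.mkArr_eq_iff.1 ha
  obtain ⟨l, hi', hj', e'⟩ := S.mkArr_eq_iff.1 hb
  obtain ⟨m, hk, hl⟩ := exists_ge_ge k l
  refine S.mkArr_eq_iff.2 ⟨m, hi.trans hk, hj.trans hk, ?_⟩
  rw [Hom.arr_comp, Hom.arr_comp]
  refine TGpd.comp_congr _ ?_ ?_ _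
  · rw [← S.arr_map i k m hi hk, ← S.arr_map j k m hj hk, e]
  · rw [← S.arr_map i l m hi' hl, ← S.arr_map j l m hj' hl, e']

/-- The composition of the colimit is computed by any composable representatives. -/
theorem colimComp_mk {i : I} (a b : (S.gpd i).Arr) (h : (S.gpd i).tgt a = (S.gpd i).src b)
    (h' : S.colimTgt (S.mkArr i a) = S.colimSrc (S.mkArr i b)) :
    S.colimComp (S.mkArr i a) (S.mkArr i b) h' = S.mkArr i ((S.gpd i).comp a b h) :=
  S.mkArr_comp_congr _ _ (S.exists_composable _ _ h').choose_spec.1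
    (S.exists_composable _ _ h').choose_spec.2

theorem colimComp_exists (a b : S.ColimArr) (h : S.colimTgt a = S.colimSrc b) :
    ∃ (i : I) (x y : (S.gpd i).Arr) (e : (S.gpd i).tgt x = (S.gpd i).src y),
      S.mkArr i x = a ∧ S.mkArr i y = b ∧
        S.colimComp a b h = S.mkArr i ((S.gpd i).comp x y e) :=
  ⟨_, _, _, (S.exists_composable a b h).choose.2.2, (S.exists_composable a b h).choose_spec.1,
    (S.exists_composable a b h).choose_spec.2, rfl⟩

/-- The colimit of a directed system of groupoids: objects and arrows are the colimits of the
spaces of objects and of arrows. -/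
noncomputable def colimit : TGpd.{u} where
  Obj := S.ColimObj
  Arr := S.ColimArr
  src := S.colimSrc
  tgt := S.colimTgt
  unit := S.colimUnit
  inv := S.colimInv
  comp := S.colimComp
  src_unit := by
    rintro ⟨i, x⟩
    exact congrArg (S.mkObj i) ((S.gpd i).src_unit x)
  tgt_unit := by
    rintro ⟨i, x⟩
    exact congrArg (S.mkObj i) ((S.gpd i).tgt_unit x)
  src_inv := by
    rintro ⟨i, x⟩
    exact congrArg (S.mkObj i) ((S.gpd i).src_inv x)
  tgt_inv := by
    rintro ⟨i, x⟩
    exact congrArg (S.mkObj i) ((S.gpd i).tgt_inv x)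
  src_comp a b h := by
    obtain ⟨i, x, y, e, rfl, rfl, hc⟩ := S.colimComp_exists a b h
    rw [hc]
    exact congrArg (S.mkObj i) ((S.gpd i).src_comp x y e)
  tgt_comp a b h := by
    obtain ⟨i, x, y, e, rfl, rfl, hc⟩ := S.colimComp_exists a b h
    rw [hc]
    exact congrArg (S.mkObj i) ((S.gpd i).tgt_comp x y e)
  unit_comp := by
    rintro ⟨i, x⟩
    exact (S.colimComp_mk _ x ((S.gpd i).tgt_unit _) _).trans
      (congrArg (S.mkArr i) ((S.gpd i).unit_comp x))
  comp_unit := by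
    rintro ⟨i, x⟩
    exact (S.colimComp_mk x _ ((S.gpd i).src_unit _).symm _).trans
      (congrArg (S.mkArr i) ((S.gpd i).comp_unit x))
  inv_comp := by
    rintro ⟨i, x⟩
    exact (S.colimComp_mk _ x ((S.gpd i).tgt_inv _) _).trans
      (congrArg (S.mkArr i) ((S.gpd i).inv_comp x))
  comp_inv := by
    rintro ⟨i, x⟩
    exact (S.colimComp_mk x _ ((S.gpd i).src_inv _).symm _).trans
      (congrArg (S.mkArr i) ((S.gpd i).comp_inv x))
  assoc a b c hab hbc := by
    obtain ⟨i, x, y, z, rfl, rfl, rfl⟩ := DirectLimit.exists_eq_mk₃ _ a b c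
    obtain ⟨k, hk, _, e⟩ := S.mkObj_eq_iff.1 hab
    obtain ⟨l, hl, _, e'⟩ := S.mkObj_eq_iff.1 hbc
    obtain ⟨m, hkm, hlm⟩ := exists_ge_ge k l
    have key : ∀ (x' y' z' : (S.gpd m).Arr) (a b c : S.ColimArr) (_ : S.mkArr m x' = a)
        (_ : S.mkArr m y' = b) (_ : S.mkArr m z' = c) (_ : (S.gpd m).tgt x' = (S.gpd m).src y')
        (_ : (S.gpd m).tgt y' = (S.gpd m).src z') (h1 h2 h3 h4),
        S.colimComp (S.colimComp a b h1) c h2 = S.colimComp a (S.colimComp b c h3) h4 := by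
      rintro x' y' z' _ _ _ rfl rfl rfl hx hy h1 h2 h3 h4
      have e1 := S.colimComp_mk x' y' hx h1
      have e2 := S.colimComp_mk y' z' hy h3
      calc S.colimComp (S.colimComp _ _ h1) _ h2
          = S.colimComp (S.mkArr m ((S.gpd m).comp x' y' hx)) (S.mkArr m z') (e1 ▸ h2) := by
            simp only [e1]
        _ = S.mkArr m ((S.gpd m).comp ((S.gpd m).comp x' y' hx) z' (by simp [hy])) :=
            S.colimComp_mk _ _ _ _
        _ = S.mkArr m ((S.gpd m).comp x' ((S.gpd m).comp y' z' hy) (by simp [hx])) :=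
            congrArg _ ((S.gpd m).assoc _ _ _ _ _)
        _ = S.colimComp (S.mkArr m x') (S.mkArr m ((S.gpd m).comp y' z' hy)) (e2 ▸ h4) :=
            (S.colimComp_mk _ _ _ _).symm
        _ = S.colimComp _ (S.colimComp _ _ h3) h4 := by simp only [e2]
    refine key ((S.map i m (hk.trans hkm)).arr x) ((S.map i m (hk.trans hkm)).arr y)
      ((S.map i m (hk.trans hkm)).arr z) _ _ _ (S.mkArr_map _ _ _ _) (S.mkArr_map _ _ _ _)
      (S.mkArr_map _ _ _ _) ?_ ?_ _ _ _ _
    · rw [Hom.tgt_arr, Hom.src_arr, ← S.obj_map i k m hk hkm, ← S.obj_map i k m hk hkm]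
      exact congrArg _ e
    · rw [Hom.tgt_arr, Hom.src_arr, ← S.obj_map i l m hl hlm, ← S.obj_map i l m hl hlm]
      exact congrArg _ e'

/-- The canonical morphism from one of the groupoids of the system to the colimit. -/
noncomputable def ι (i : I) : Hom (S.gpd i) S.colimit where
  obj := ⟨fun x => S.mkObj i x, continuous_quotient_mk'.comp continuous_sigmaMk⟩
  arr := ⟨fun a => S.mkArr i a, continuous_quotient_mk'.comp continuous_sigmaMk⟩
  src_arr _ := rfl
  tgt_arr _ := rfl
  arr_unit _ := rfl
  arr_comp a b h := (S.colimComp_mk a b h ((S.colimTgt_mk a).trans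
    ((congrArg (S.mkObj i) h).trans (S.colimSrc_mk b).symm))).symm

/-- The morphism out of the colimit induced by a compatible family of morphisms. -/
noncomputable def desc {H : TGpd.{u}} (F : ∀ i, Hom (S.gpd i) H)
    (hobj : ∀ i j h x, (F i).obj x = (F j).obj ((S.map i j h).obj x))
    (harr : ∀ i j h a, (F i).arr a = (F j).arr ((S.map i j h).arr a)) : Hom S.colimit H where
  obj := ⟨DirectLimit.lift _ (fun i x => (F i).obj x) hobj,
    continuous_coinduced_dom.2 (continuous_sigma fun i => (F i).obj.continuous)⟩
  arr := ⟨DirectLimit.lift _ (fun i a => (F i).arr a) harr,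
    continuous_coinduced_dom.2 (continuous_sigma fun i => (F i).arr.continuous)⟩
  src_arr := by
    rintro ⟨i, a⟩
    exact (F i).src_arr a
  tgt_arr := by
    rintro ⟨i, a⟩
    exact (F i).tgt_arr a
  arr_unit := by
    rintro ⟨i, a⟩
    exact (F i).arr_unit a
  arr_comp a b h := by
    obtain ⟨i, x, y, e, rfl, rfl, hc⟩ := S.colimComp_exists a b h
    exact (congrArg (DirectLimit.lift _ (fun i a => (F i).arr a) harr) hc).trans
      ((F i).arr_comp x y e)

end DirSystem

/-- The subgroupoid, with the subspace topologies, of the objects and arrows that are fixed by all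
members of a family of endomorphisms. -/
def fixedGpd (G : TGpd.{u}) {Z : Type*} (T : Z → Hom G G) : TGpd.{u} where
  Obj := {x : G.Obj // ∀ z, (T z).obj x = x}
  Arr := {a : G.Arr // ∀ z, (T z).arr a = a}
  src a := ⟨G.src a.1, fun z => by rw [← (T z).src_arr, a.2 z]⟩
  tgt a := ⟨G.tgt a.1, fun z => by rw [← (T z).tgt_arr, a.2 z]⟩
  unit x := ⟨G.unit x.1, fun z => by rw [(T z).arr_unit, x.2 z]⟩
  inv a := ⟨G.inv a.1, fun z => by rw [(T z).arr_inv, a.2 z]⟩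
  comp a b h := ⟨G.comp a.1 b.1 (congrArg Subtype.val h), fun z => by
    rw [(T z).arr_comp]
    exact G.comp_congr (a.2 z) (b.2 z) _⟩
  src_unit x := Subtype.ext (G.src_unit _)
  tgt_unit x := Subtype.ext (G.tgt_unit _)
  src_inv x := Subtype.ext (G.src_inv _)
  tgt_inv x := Subtype.ext (G.tgt_inv _)
  src_comp a b h := Subtype.ext (G.src_comp _ _ _)
  tgt_comp a b h := Subtype.ext (G.tgt_comp _ _ _)
  unit_comp a := Subtype.ext (G.unit_comp _)
  comp_unit a := Subtype.ext (G.comp_unit _)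
  inv_comp a := Subtype.ext (G.inv_comp _)
  comp_inv a := Subtype.ext (G.comp_inv _)
  assoc a b c hab hbc := Subtype.ext (G.assoc _ _ _ _ _)

/-! ### Admissible covers of the circle and the groupoids of the circle -/

end TGpd

/-- For a finite set `P` of points of the circle `ℝ / ℤ` and a lift `a ∈ ℝ` of one of them, the
interval `(a - ε, a⁺ + ε)`, where `a⁺` is the next lift of a point of `P` after `a`; see
`CircleCover.interval_eq_Ioo`. -/
def coverInterval (P : Set UnitAddCircle) (ε a : ℝ) : Set ℝ :=
  {x | a - ε < x ∧ ∀ b : ℝ, (b : UnitAddCircle) ∈ P → a < b → x < b + ε}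

/-- The data of an admissible cover of the circle `ℝ / ℤ`: a nonempty finite set of points and
`ε > 0`. The pulled back cover of `ℝ` consists of the intervals `(a - ε, a⁺ + ε)`, where `a` runs
through the lifts of the points and `a⁺` is the next lift after `a`; the cover is admissible if
triple intersections of these intervals are empty. -/
structure CircleCover where
  pts : Set UnitAddCircle
  finite : pts.Finite
  nonempty : pts.Nonempty
  ε : ℝ
  ε_pos : 0 < ε
  admissible : ∀ a b c : ℝ, (a : UnitAddCircle) ∈ pts → (b : UnitAddCircle) ∈ pts →
    (c : UnitAddCircle) ∈ pts → a < b → b < c →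
    coverInterval pts ε a ∩ coverInterval pts ε b ∩ coverInterval pts ε c = ∅

namespace CircleCover

/-- The index set of the pulled back cover of `ℝ`: the lifts to `ℝ` of the chosen points. It is
regarded as a discrete set. -/
@[ext]
structure Index (W : CircleCover) where
  val : ℝ
  mem : (val : UnitAddCircle) ∈ W.pts

instance (W : CircleCover) : TopologicalSpace W.Index := ⊥

instance (W : CircleCover) : DiscreteTopology W.Index := ⟨rfl⟩

/-- The interval `(a - ε, a⁺ + ε)` of the pulled back cover. -/
def interval (W : CircleCover) (a : W.Index) : Set ℝ := coverInterval W.pts W.ε a.val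

theorem interval_eq_Ioo (W : CircleCover) (a b : W.Index) (hab : a.val < b.val)
    (hb : ∀ c : W.Index, a.val < c.val → b.val ≤ c.val) :
    W.interval a = Set.Ioo (a.val - W.ε) (b.val + W.ε) := by
  ext x
  refine ⟨fun h => ⟨h.1, h.2 b.val b.mem hab⟩,
    fun h => ⟨h.1, fun c hc hac => h.2.trans_le ?_⟩⟩
  have := hb ⟨c, hc⟩ hac
  simp only at this
  linarith

/-- Translation of an index by an integer. -/
def Index.shift {W : CircleCover} (a : W.Index) (l : ℤ) : W.Index where
  val := a.val + l
  mem := by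
    have h : ((l : ℝ) : UnitAddCircle) = 0 :=
      (AddCircle.coe_eq_zero_iff (p := (1 : ℝ))).2 ⟨l, by simp⟩
    rw [AddCircle.coe_add, h, add_zero]
    exact a.mem

@[simp]
theorem Index.shift_val {W : CircleCover} (a : W.Index) (l : ℤ) :
    (a.shift l).val = a.val + l := rfl

@[simp]
theorem Index.shift_shift {W : CircleCover} (a : W.Index) (l k : ℤ) :
    (a.shift l).shift k = a.shift (l + k) := by
  ext; simp [add_assoc]

@[simp]
theorem Index.shift_zero {W : CircleCover} (a : W.Index) : a.shift 0 = a := by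
  ext; simp

theorem mem_interval_shift {W : CircleCover} {a : W.Index} {x : ℝ} (l : ℤ)
    (h : x ∈ W.interval a) : x + l ∈ W.interval (a.shift l) := by
  refine ⟨?_, fun b hbm hb => ?_⟩
  · have := h.1
    simp only [Index.shift_val]
    linarith
  · have := h.2 _ (Index.shift ⟨b, hbm⟩ (-l) : W.Index).mem (by simp at hb ⊢; linarith)
    simp at this
    linarith

/-- `W'` refines `W` (written `W ≤ W'`) if it has more points and a smaller `ε`. -/
instance : Preorder CircleCover where
  le W W' := W.pts ⊆ W'.pts ∧ W'.ε ≤ W.ε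
  le_refl W := ⟨subset_rfl, le_rfl⟩
  le_trans _ _ _ h h' := ⟨h.1.trans h'.1, h'.2.trans h.2⟩

/-- For every real number there is a greatest lift below it. -/
theorem exists_floor (W : CircleCover) (x : ℝ) :
    ∃ a : W.Index, a.val ≤ x ∧ ∀ b : W.Index, b.val ≤ x → b.val ≤ a.val := by
  obtain ⟨q, hq, hmax⟩ := Set.exists_max_image W.pts
    (fun q => ((AddCircle.equivIoc (1 : ℝ) (x - 1) q : Set.Ioc (x - 1) (x - 1 + 1)) : ℝ))
    W.finite W.nonempty
  have hcoe : ∀ q : UnitAddCircle,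
      (((AddCircle.equivIoc (1 : ℝ) (x - 1) q : Set.Ioc (x - 1) (x - 1 + 1)) : ℝ) :
        UnitAddCircle) = q := fun q => (AddCircle.equivIoc (1 : ℝ) (x - 1)).symm_apply_apply q
  refine ⟨⟨_, by rw [hcoe q]; exact hq⟩, ?_, fun b hb => ?_⟩
  · have := (AddCircle.equivIoc (1 : ℝ) (x - 1) q).2.2
    simp only
    linarith
  · rcases le_or_gt b.val (x - 1) with h | h
    · exact h.trans (AddCircle.equivIoc (1 : ℝ) (x - 1) q).2.1.le
    · have h1 := hmax _ b.mem
      have h2 : ((AddCircle.equivIoc (1 : ℝ) (x - 1) (b.val : UnitAddCircle) :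
          Set.Ioc (x - 1) (x - 1 + 1)) : ℝ) = b.val := by
        have := (AddCircle.equivIoc (1 : ℝ) (x - 1)).apply_symm_apply
          ⟨b.val, h, by linarith⟩
        exact congrArg Subtype.val this
      rw [h2] at h1
      exact h1

/-- The greatest lift below a real number. -/
noncomputable def floor (W : CircleCover) (x : ℝ) : W.Index := (W.exists_floor x).choose

theorem floor_le (W : CircleCover) (x : ℝ) : (W.floor x).val ≤ x :=
  (W.exists_floor x).choose_spec.1

theorem le_floor (W : CircleCover) {x : ℝ} {b : W.Index} (h : b.val ≤ x) :
    b.val ≤ (W.floor x).val :=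
  (W.exists_floor x).choose_spec.2 b h

theorem floor_eq (W : CircleCover) {x : ℝ} {a : W.Index} (h : a.val ≤ x)
    (h' : ∀ b : W.Index, b.val ≤ x → b.val ≤ a.val) : W.floor x = a :=
  Index.ext (le_antisymm (h' _ (W.floor_le x)) (W.le_floor h))

theorem floor_val (W : CircleCover) (a : W.Index) : W.floor a.val = a :=
  W.floor_eq le_rfl fun _ h => h

theorem floor_add_int (W : CircleCover) (x : ℝ) (l : ℤ) :
    W.floor (x + l) = (W.floor x).shift l := by
  refine W.floor_eq (by simpa using W.floor_le x) fun b hb => ?_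
  have := W.le_floor (x := x) (b := b.shift (-l)) (by simp; linarith)
  simp at this ⊢
  linarith

theorem floor_floor {W W' : CircleCover} (h : W ≤ W') (x : ℝ) :
    W.floor (W'.floor x).val = W.floor x :=
  W.floor_eq ((W.floor_le _).trans (W'.floor_le _)) (fun b hb => by
    refine W.le_floor ?_
    exact W'.le_floor (b := ⟨b.val, h.1 b.mem⟩) hb) |>.symm

/-- Each interval of the finer cover is contained in the interval of the coarser one whose left
point is the nearest one to the left. -/
theorem mem_interval_floor {W W' : CircleCover} (h : W ≤ W') {a : W'.Index} {x : ℝ}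
    (hx : x ∈ W'.interval a) : x ∈ W.interval (W.floor a.val) := by
  have hε := h.2
  refine ⟨?_, fun b hbm hb => ?_⟩
  · have := W.floor_le a.val
    have := hx.1
    linarith
  · have hab : a.val < b := by
      by_contra hcon
      exact absurd (W.le_floor (b := ⟨b, hbm⟩) (not_lt.1 hcon)) (not_le.2 hb)
    have := hx.2 b (h.1 hbm) hab
    linarith

/-- Any two admissible covers have a common admissible refinement. -/
instance : IsDirectedOrder CircleCover where
  directed W W' := by
    have hfin : (W.pts ∪ W'.pts).Finite := W.finite.union W'.finite
    obtain ⟨δ, hδ, hδ1, hsep⟩ : ∃ δ : ℝ, 0 < δ ∧ δ ≤ 1 ∧ ∀ p ∈ W.pts ∪ W'.pts,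
        ∀ q ∈ W.pts ∪ W'.pts, p ≠ q → δ ≤ ‖p - q‖ := by
      have hD : ((fun r : UnitAddCircle × UnitAddCircle => ‖r.1 - r.2‖) ''
          (((W.pts ∪ W'.pts) ×ˢ (W.pts ∪ W'.pts)) ∩ {r | r.1 ≠ r.2})).Finite :=
        ((hfin.prod hfin).subset Set.inter_subset_left).image _
      obtain ⟨m, hm, hmin⟩ := Set.exists_min_image _ id (hD.insert 1) ⟨1, Set.mem_insert _ _⟩
      refine ⟨m, ?_, hmin 1 (Set.mem_insert _ _), fun p hp q hq hpq =>
        hmin _ (Set.mem_insert_of_mem _ ⟨(p, q), ⟨⟨hp, hq⟩, hpq⟩, rfl⟩)⟩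
      rcases hm with rfl | ⟨r, hr, rfl⟩
      · exact one_pos
      · exact norm_pos_iff.2 (sub_ne_zero.2 hr.2)
    have hgap : ∀ a b : ℝ, (a : UnitAddCircle) ∈ W.pts ∪ W'.pts →
        (b : UnitAddCircle) ∈ W.pts ∪ W'.pts → a < b → δ ≤ b - a := by
      intro a b ha hb hab
      by_cases hne : (b : UnitAddCircle) = a
      · have h0 : ((b - a : ℝ) : UnitAddCircle) = 0 := by rw [AddCircle.coe_sub, hne, sub_self]
        obtain ⟨n, hn⟩ := (AddCircle.coe_eq_zero_iff (p := (1 : ℝ))).1 h0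
        have hn' : (n : ℝ) = b - a := by simpa using hn
        have hpos : (0 : ℝ) < n := by linarith
        have : (1 : ℝ) ≤ n := by exact_mod_cast (Int.cast_pos.1 hpos : 0 < n)
        linarith
      · have h1 := hsep _ hb _ ha hne
        have h2 : ‖((b - a : ℝ) : UnitAddCircle)‖ ≤ |b - a| := by
          rw [← Real.norm_eq_abs]
          exact QuotientAddGroup.norm_mk_le_norm
        rw [AddCircle.coe_sub, abs_of_pos (by linarith)] at h2
        linarith
    refine ⟨⟨W.pts ∪ W'.pts, hfin, W.nonempty.inl, min (min W.ε W'.ε) (δ / 2), ?_, ?_⟩, ?_, ?_⟩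
    · exact lt_min (lt_min W.ε_pos W'.ε_pos) (half_pos hδ)
    · intro a b c ha hb hc hab hbc
      refine Set.eq_empty_of_forall_notMem fun x hx => ?_
      have h1 := hx.2.1
      have h2 := hx.1.1.2 b hb hab
      have h3 := hgap b c hb hc hbc
      have h4 := min_le_right (min W.ε W'.ε) (δ / 2)
      linarith
    · exact ⟨Set.subset_union_left, (min_le_left _ _).trans (min_le_left _ _)⟩
    · exact ⟨Set.subset_union_right, (min_le_left _ _).trans (min_le_right _ _)⟩

/-- The groupoid of the circle attached to a cover. Its objects are the pairs `(x, a)` with `x` in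
the interval `W_a`, i.e. the disjoint union of the intervals; its arrows are the `((x, a, b), l)`
with `x ∈ W_a ∩ W_b` and `l ∈ ℤ`, from `(x, a)` to `(x + l, b + l)`. -/
def circle (W : CircleCover) : TGpd.{0} where
  Obj := {p : ℝ × W.Index // p.1 ∈ W.interval p.2}
  Arr := {r : (ℝ × W.Index × W.Index) × ℤ //
    r.1.1 ∈ W.interval r.1.2.1 ∧ r.1.1 ∈ W.interval r.1.2.2}
  src r := ⟨(r.1.1.1, r.1.1.2.1), r.2.1⟩
  tgt r := ⟨(r.1.1.1 + r.1.2, r.1.1.2.2.shift r.1.2), mem_interval_shift _ r.2.2⟩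
  unit p := ⟨((p.1.1, p.1.2, p.1.2), 0), p.2, p.2⟩
  inv r := ⟨((r.1.1.1 + r.1.2, r.1.1.2.2.shift r.1.2, r.1.1.2.1.shift r.1.2), -r.1.2),
    mem_interval_shift _ r.2.2, mem_interval_shift _ r.2.1⟩
  comp r r' h := ⟨((r.1.1.1, r.1.1.2.1, r'.1.1.2.2.shift (-r.1.2)), r.1.2 + r'.1.2), r.2.1, by
    have h1 : r.1.1.1 + r.1.2 = r'.1.1.1 := congrArg (fun p => p.1.1) h
    have h2 := mem_interval_shift (-r.1.2) r'.2.2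
    rw [← h1] at h2
    simpa using h2⟩
  src_unit p := rfl
  tgt_unit p := by simp
  src_inv r := rfl
  tgt_inv r := by simp
  src_comp r r' h := rfl
  tgt_comp r r' h := by
    have h1 : r.1.1.1 + r.1.2 = r'.1.1.1 := congrArg (fun p => p.1.1) h
    refine Subtype.ext (Prod.ext ?_ ?_)
    · simp [← h1, add_assoc]
    · simp
  unit_comp r := by simp
  comp_unit r := by simp
  inv_comp r := by simp
  comp_inv r := by simp
  assoc r r' r'' h h' := by simp [add_comm, add_left_comm]

theorem continuous_shift (W : CircleCover) :
    Continuous fun p : W.Index × ℤ => p.1.shift p.2 :=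
  continuous_of_discreteTopology

theorem continuous_translate : Continuous fun p : ℝ × ℤ => p.1 + (p.2 : ℝ) :=
  continuous_fst.add ((continuous_of_discreteTopology (f := fun n : ℤ => (n : ℝ))).comp
    continuous_snd)

instance (W : CircleCover) : W.circle.IsTopological where
  continuous_src := by
    refine Continuous.subtype_mk ?_ _
    fun_prop
  continuous_tgt := by
    refine Continuous.subtype_mk (Continuous.prodMk ?_ ?_) _
    · exact continuous_translate.comp
        (by fun_prop : Continuous fun r : W.circle.Arr => (r.1.1.1, r.1.2))
    · exact W.continuous_shift.comp
        (by fun_prop : Continuous fun r : W.circle.Arr => (r.1.1.2.2, r.1.2))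
  continuous_unit := by
    refine Continuous.subtype_mk ?_ _
    fun_prop
  continuous_inv := by
    refine Continuous.subtype_mk (Continuous.prodMk (Continuous.prodMk ?_
      (Continuous.prodMk ?_ ?_)) ?_) _
    · exact continuous_translate.comp
        (by fun_prop : Continuous fun r : W.circle.Arr => (r.1.1.1, r.1.2))
    · exact W.continuous_shift.comp
        (by fun_prop : Continuous fun r : W.circle.Arr => (r.1.1.2.2, r.1.2))
    · exact W.continuous_shift.comp
        (by fun_prop : Continuous fun r : W.circle.Arr => (r.1.1.2.1, r.1.2))
    · fun_prop
  continuous_comp := by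
    have h1 : Continuous fun p : {p : W.circle.Arr × W.circle.Arr //
        W.circle.tgt p.1 = W.circle.src p.2} => p.1.1.1 :=
      continuous_subtype_val.comp (continuous_fst.comp continuous_subtype_val)
    have h2 : Continuous fun p : {p : W.circle.Arr × W.circle.Arr //
        W.circle.tgt p.1 = W.circle.src p.2} => p.1.2.1 :=
      continuous_subtype_val.comp (continuous_snd.comp continuous_subtype_val)
    refine Continuous.subtype_mk (Continuous.prodMk (Continuous.prodMk ?_
      (Continuous.prodMk ?_ ?_)) ?_) _
    · exact continuous_fst.comp (continuous_fst.comp h1)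
    · exact continuous_fst.comp (continuous_snd.comp (continuous_fst.comp h1))
    · exact W.continuous_shift.comp ((continuous_snd.comp (continuous_snd.comp
        (continuous_fst.comp h2))).prodMk (continuous_snd.comp h1).neg)
    · exact (continuous_snd.comp h1).add (continuous_snd.comp h2)

/-- The natural morphism from the groupoid of a finer cover to that of a coarser one. -/
noncomputable def refineHom {W W' : CircleCover} (h : W ≤ W') : W'.circle.Hom W.circle where
  obj := ⟨fun p => ⟨(p.1.1, W.floor p.1.2.val), mem_interval_floor h p.2⟩, by
    have hf : Continuous fun a : W'.Index => W.floor a.val := continuous_of_discreteTopology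
    refine Continuous.subtype_mk (Continuous.prodMk ?_ (hf.comp ?_)) _
    · exact continuous_fst.comp continuous_subtype_val
    · exact continuous_snd.comp continuous_subtype_val⟩
  arr := ⟨fun r => ⟨((r.1.1.1, W.floor r.1.1.2.1.val, W.floor r.1.1.2.2.val), r.1.2),
    mem_interval_floor h r.2.1, mem_interval_floor h r.2.2⟩, by
    have hf : Continuous fun a : W'.Index => W.floor a.val := continuous_of_discreteTopology
    have h1 : Continuous fun r : W'.circle.Arr => r.1 := continuous_subtype_val
    refine Continuous.subtype_mk (Continuous.prodMk (Continuous.prodMk ?_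
      (Continuous.prodMk (hf.comp ?_) (hf.comp ?_))) ?_) _
    · exact continuous_fst.comp (continuous_fst.comp h1)
    · exact continuous_fst.comp (continuous_snd.comp (continuous_fst.comp h1))
    · exact continuous_snd.comp (continuous_snd.comp (continuous_fst.comp h1))
    · exact continuous_snd.comp h1⟩
  src_arr r := rfl
  tgt_arr r := by
    refine Subtype.ext (Prod.ext rfl ?_)
    exact (W.floor_add_int _ _).symm
  arr_unit p := rfl
  arr_comp r r' e := by
    refine Subtype.ext (Prod.ext (Prod.ext rfl (Prod.ext rfl ?_)) rfl)
    exact W.floor_add_int _ _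

theorem refineHom_obj_self (W : CircleCover) (p : W.circle.Obj) :
    (refineHom (le_refl W)).obj p = p :=
  Subtype.ext (Prod.ext rfl (W.floor_val _))

theorem refineHom_arr_self (W : CircleCover) (r : W.circle.Arr) :
    (refineHom (le_refl W)).arr r = r :=
  Subtype.ext (Prod.ext (Prod.ext rfl (Prod.ext (W.floor_val _) (W.floor_val _))) rfl)

theorem refineHom_obj_comp {W W' W'' : CircleCover} (h : W ≤ W') (h' : W' ≤ W'')
    (p : W''.circle.Obj) :
    (refineHom h).obj ((refineHom h').obj p) = (refineHom (h.trans h')).obj p :=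
  Subtype.ext (Prod.ext rfl (floor_floor h _))

theorem refineHom_arr_comp {W W' W'' : CircleCover} (h : W ≤ W') (h' : W' ≤ W'')
    (r : W''.circle.Arr) :
    (refineHom h).arr ((refineHom h').arr r) = (refineHom (h.trans h')).arr r :=
  Subtype.ext (Prod.ext (Prod.ext rfl (Prod.ext (floor_floor h _) (floor_floor h _))) rfl)

/-! ### Rotation of covers -/

/-- The cover obtained by translating by `z`. -/
def rotate (W : CircleCover) (z : ℝ) : CircleCover where
  pts := {p | p - (z : UnitAddCircle) ∈ W.pts}
  finite := W.finite.preimage (sub_left_injective.injOn)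
  nonempty := by
    obtain ⟨p, hp⟩ := W.nonempty
    exact ⟨p + z, by simpa using hp⟩
  ε := W.ε
  ε_pos := W.ε_pos
  admissible a b c ha hb hc hab hbc := by
    refine Set.eq_empty_of_forall_notMem fun x hx => ?_
    have key : ∀ d : ℝ, x ∈ coverInterval {p | p - (z : UnitAddCircle) ∈ W.pts} W.ε d →
        x - z ∈ coverInterval W.pts W.ε (d - z) := by
      intro d hd
      refine ⟨by linarith [hd.1], fun e he hde => ?_⟩
      have := hd.2 (e + z) (by simpa [AddCircle.coe_add] using he) (by linarith)
      linarith
    have h := W.admissible (a - z) (b - z) (c - z) (by simpa [AddCircle.coe_sub] using ha)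
      (by simpa [AddCircle.coe_sub] using hb) (by simpa [AddCircle.coe_sub] using hc)
      (by linarith) (by linarith)
    exact (Set.eq_empty_iff_forall_notMem.1 h) (x - z)
      ⟨⟨key a hx.1.1, key b hx.1.2⟩, key c hx.2⟩

/-- Translating back an index of the translated cover. -/
def Index.unrotate {W : CircleCover} {z : ℝ} (a : (W.rotate z).Index) : W.Index where
  val := a.val - z
  mem := by
    rw [AddCircle.coe_sub]
    exact a.mem

theorem mem_interval_unrotate {W : CircleCover} {z x : ℝ} {a : (W.rotate z).Index}
    (h : x ∈ (W.rotate z).interval a) : x - z ∈ W.interval a.unrotate := by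
  refine ⟨?_, fun e he hde => ?_⟩
  · have h1 : a.val - W.ε < x := h.1
    change a.val - z - W.ε < x - z
    linarith
  · have hde' : a.val - z < e := hde
    have h2 : x < e + z + W.ε := h.2 (e + z)
      (by change _ - _ ∈ W.pts; simpa [AddCircle.coe_add] using he) (by linarith)
    linarith

theorem unrotate_shift {W : CircleCover} {z : ℝ} (a : (W.rotate z).Index) (l : ℤ) :
    (a.shift l).unrotate = a.unrotate.shift l := by
  ext
  simp [Index.unrotate]
  ring

/-- The morphism `(x, a) ↦ (x - z, a - z)` from the groupoid of the translated cover. -/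
def unrotateHom (W : CircleCover) (z : ℝ) : (W.rotate z).circle.Hom W.circle where
  obj := ⟨fun p => ⟨(p.1.1 - z, p.1.2.unrotate), mem_interval_unrotate p.2⟩, by
    have hf : Continuous fun a : (W.rotate z).Index => a.unrotate :=
      continuous_of_discreteTopology
    refine Continuous.subtype_mk (Continuous.prodMk (Continuous.sub ?_ continuous_const)
      (hf.comp ?_)) _
    · exact continuous_fst.comp continuous_subtype_val
    · exact continuous_snd.comp continuous_subtype_val⟩
  arr := ⟨fun r => ⟨((r.1.1.1 - z, r.1.1.2.1.unrotate, r.1.1.2.2.unrotate), r.1.2),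
    mem_interval_unrotate r.2.1, mem_interval_unrotate r.2.2⟩, by
    have hf : Continuous fun a : (W.rotate z).Index => a.unrotate :=
      continuous_of_discreteTopology
    have h1 : Continuous fun r : (W.rotate z).circle.Arr => r.1 := continuous_subtype_val
    refine Continuous.subtype_mk (Continuous.prodMk (Continuous.prodMk
      (Continuous.sub ?_ continuous_const) (Continuous.prodMk (hf.comp ?_) (hf.comp ?_))) ?_) _
    · exact continuous_fst.comp (continuous_fst.comp h1)
    · exact continuous_fst.comp (continuous_snd.comp (continuous_fst.comp h1))
    · exact continuous_snd.comp (continuous_snd.comp (continuous_fst.comp h1))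
    · exact continuous_snd.comp h1⟩
  src_arr r := rfl
  tgt_arr r := by
    refine Subtype.ext (Prod.ext ?_ (unrotate_shift _ _).symm)
    exact (add_sub_right_comm _ _ _).symm
  arr_unit p := rfl
  arr_comp r r' e := by
    refine Subtype.ext (Prod.ext (Prod.ext rfl (Prod.ext rfl ?_)) rfl)
    exact unrotate_shift _ _

theorem rotate_mono {W W' : CircleCover} (h : W ≤ W') (z : ℝ) : W.rotate z ≤ W'.rotate z :=
  ⟨fun _ hp => h.1 hp, h.2⟩

theorem floor_unrotate {W W' : CircleCover} (z : ℝ)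
    (a : (W'.rotate z).Index) : ((W.rotate z).floor a.val).unrotate = W.floor a.unrotate.val := by
  refine (W.floor_eq ?_ fun b hb => ?_).symm
  · exact sub_le_sub_right ((W.rotate z).floor_le a.val) z
  · have hb' : b.val ≤ a.val - z := hb
    have := (W.rotate z).le_floor (x := a.val)
      (b := ⟨b.val + z, by change _ - _ ∈ W.pts; simpa [AddCircle.coe_add] using b.mem⟩)
      (by simp only; linarith)
    change b.val ≤ _ - z
    simp only at this
    linarith

theorem refine_unrotate_obj {W W' : CircleCover} (h : W ≤ W') (z : ℝ)
    (p : (W'.rotate z).circle.Obj) :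
    (W.unrotateHom z).obj ((refineHom (rotate_mono h z)).obj p) =
      (refineHom h).obj ((W'.unrotateHom z).obj p) :=
  Subtype.ext (Prod.ext rfl (floor_unrotate z _))

theorem refine_unrotate_arr {W W' : CircleCover} (h : W ≤ W') (z : ℝ)
    (r : (W'.rotate z).circle.Arr) :
    (W.unrotateHom z).arr ((refineHom (rotate_mono h z)).arr r) =
      (refineHom h).arr ((W'.unrotateHom z).arr r) :=
  Subtype.ext (Prod.ext (Prod.ext rfl (Prod.ext (floor_unrotate z _) (floor_unrotate z _))) rfl)

end CircleCover

namespace TGpd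

/-! ### The loop groupoid -/

section Loop

variable (G : TGpd.{u}) [G.IsTopological]

/-- The directed system of the groupoids `LG(W)` of morphisms from the groupoid of the circle
attached to the cover `W` to `G`. -/
noncomputable def loopSystem : DirSystem.{u} CircleCover where
  gpd W := mapGpd W.circle G
  map _ _ h := precomp (CircleCover.refineHom h) G
  obj_self W F := Hom.ext' (fun x => congrArg F.obj (W.refineHom_obj_self x))
    (fun a => congrArg F.arr (W.refineHom_arr_self a))
  arr_self W L := MapArr.ext'
    (Hom.ext' (fun x => congrArg L.dom.obj (W.refineHom_obj_self x))
      (fun a => congrArg L.dom.arr (W.refineHom_arr_self a)))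
    (Hom.ext' (fun x => congrArg L.cod.obj (W.refineHom_obj_self x))
      (fun a => congrArg L.cod.arr (W.refineHom_arr_self a)))
    (fun r => congrArg L.app (W.refineHom_arr_self r))
  obj_map _ _ _ h h' F :=
    Hom.ext' (fun x => congrArg F.obj (CircleCover.refineHom_obj_comp h h' x))
      (fun a => congrArg F.arr (CircleCover.refineHom_arr_comp h h' a))
  arr_map _ _ _ h h' L := MapArr.ext'
    (Hom.ext' (fun x => congrArg L.dom.obj (CircleCover.refineHom_obj_comp h h' x))
      (fun a => congrArg L.dom.arr (CircleCover.refineHom_arr_comp h h' a)))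
    (Hom.ext' (fun x => congrArg L.cod.obj (CircleCover.refineHom_obj_comp h h' x))
      (fun a => congrArg L.cod.arr (CircleCover.refineHom_arr_comp h h' a)))
    (fun r => congrArg L.app (CircleCover.refineHom_arr_comp h h' r))

/-- The loop groupoid `LG`: the colimit of the `LG(W)` over all admissible covers `W`. -/
noncomputable def loopGpd : TGpd.{u} := G.loopSystem.colimit

/-- The action of `z ∈ ℝ` on the loop groupoid: `Ψ` defined on the cover `W` is sent to `Ψᶻ`
defined on the cover translated by `z`, where `Ψᶻ((x, a, b), l) = Ψ((x - z, a - z, b - z), l)`. -/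
noncomputable def rotateLoop (z : ℝ) : Hom G.loopGpd G.loopGpd :=
  G.loopSystem.desc
    (fun W => (precomp (W.unrotateHom z) G : Hom (mapGpd W.circle G) _).trans
      (G.loopSystem.ι (W.rotate z)))
    (fun W W' h F => by
      refine (G.loopSystem.mkObj_map (W.rotate z) (W'.rotate z)
        (CircleCover.rotate_mono h z) _).symm.trans ?_
      refine congrArg (G.loopSystem.mkObj (W'.rotate z)) ?_
      exact Hom.ext' (fun x => congrArg (Hom.obj F) (CircleCover.refine_unrotate_obj h z x))
        (fun a => congrArg (Hom.arr F) (CircleCover.refine_unrotate_arr h z a)))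
    (fun W W' h L => by
      refine (G.loopSystem.mkArr_map (W.rotate z) (W'.rotate z)
        (CircleCover.rotate_mono h z) _).symm.trans ?_
      refine congrArg (G.loopSystem.mkArr (W'.rotate z)) ?_
      exact MapArr.ext'
        (Hom.ext' (fun x => congrArg (MapArr.dom L).obj (CircleCover.refine_unrotate_obj h z x))
          (fun a => congrArg (MapArr.dom L).arr (CircleCover.refine_unrotate_arr h z a)))
        (Hom.ext' (fun x => congrArg (MapArr.cod L).obj (CircleCover.refine_unrotate_obj h z x))
          (fun a => congrArg (MapArr.cod L).arr (CircleCover.refine_unrotate_arr h z a)))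
        (fun r => congrArg (MapArr.app L) (CircleCover.refine_unrotate_arr h z r)))

/-- The subgroupoid of the loop groupoid fixed by the action of `ℝ`. -/
noncomputable def fixedLoopGpd : TGpd.{u} := G.loopGpd.fixedGpd G.rotateLoop

end Loop

/-! ### Orbifold groupoids, orbifold charts and twisted sectors -/

/-- Orbifold groupoids: proper étale smooth groupoids. The structure maps are continuous, the spaces of objects and of arrows are
(Hausdorff, not necessarily second countable) smooth `n`-manifolds, source and target are local
diffeomorphisms, and `(s, t) : G₁ → G₀ × G₀` is proper. Since `s` and `t` are local
diffeomorphisms, smoothness of the other structure maps follows from their continuity. -/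
structure IsOrbifold (n : ℕ) (G : TGpd.{u}) [G.IsTopological]
    [ChartedSpace (EuclideanSpace ℝ (Fin n)) G.Obj]
    [ChartedSpace (EuclideanSpace ℝ (Fin n)) G.Arr] : Prop where
  t2_obj : T2Space G.Obj
  t2_arr : T2Space G.Arr
  isManifold_obj : IsManifold (𝓡 n) ∞ G.Obj
  isManifold_arr : IsManifold (𝓡 n) ∞ G.Arr
  isLocalDiffeomorph_src : IsLocalDiffeomorph (𝓡 n) (𝓡 n) ∞ G.src
  isLocalDiffeomorph_tgt : IsLocalDiffeomorph (𝓡 n) (𝓡 n) ∞ G.tgt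
  isProperMap : IsProperMap fun a : G.Arr => (G.src a, G.tgt a)

section Sectors

variable (G : TGpd.{u})

/-- The isotropy group `G_x` of arrows from `x` to `x`, with the topology of a subspace of `G₁`. -/
abbrev Isotropy (x : G.Obj) : Type u := {a : G.Arr // G.src a = x ∧ G.tgt a = x}

instance (x : G.Obj) : Group (G.Isotropy x) where
  mul a b := ⟨G.comp a.1 b.1 (a.2.2.trans b.2.1.symm), by simp [a.2.1], by simp [b.2.2]⟩
  one := ⟨G.unit x, by simp, by simp⟩
  inv a := ⟨G.inv a.1, by simp [a.2.2], by simp [a.2.1]⟩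
  mul_assoc a b c := Subtype.ext (G.assoc _ _ _ _ _)
  one_mul a := Subtype.ext (G.unit_comp_of _)
  mul_one a := Subtype.ext (G.comp_unit_of _)
  inv_mul_cancel a := Subtype.ext ((G.inv_comp a.1).trans (congrArg G.unit a.2.2))

/-- The equivalence relation "joined by an arrow" on objects. -/
def orbitSetoid : Setoid G.Obj where
  r x y := ∃ a, G.src a = x ∧ G.tgt a = y
  iseqv :=
    ⟨fun x => ⟨G.unit x, by simp, by simp⟩,
      fun ⟨a, h, h'⟩ => ⟨G.inv a, by simp [h'], by simp [h]⟩,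
      fun ⟨a, h, h'⟩ ⟨b, k, k'⟩ => ⟨G.comp a b (h'.trans k.symm), by simp [h], by simp [k']⟩⟩

/-- The underlying space of points `p` of the orbifold represented by `G`. -/
abbrev OrbitSpace : Type u := Quotient G.orbitSetoid

/-- An orbifold chart `(V, G_x)` at an object `x`: a connected open neighbourhood `V` of `x` in
`G₀`, together with an identification of the restriction of `G` to `V` with the action groupoid of
a right action of the isotropy group `G_x` on `V`. The arrow `arrow (y, g)` goes from `y` to the
point `y · g`; its target defines the action. -/
structure OrbifoldChart (x : G.Obj) where
  V : Set G.Obj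
  isOpen : IsOpen V
  isConnected : IsConnected V
  mem : x ∈ V
  arrow : V × G.Isotropy x ≃ₜ {a : G.Arr // G.src a ∈ V ∧ G.tgt a ∈ V}
  src_arrow : ∀ y g, G.src (arrow (y, g)).1 = y
  arrow_base : ∀ g, (arrow (⟨x, mem⟩, g)).1 = g.1
  arrow_mul : ∀ y g h, (arrow (y, g * h)).1 =
    G.comp (arrow (y, g)).1 (arrow (⟨G.tgt (arrow (y, g)).1, (arrow (y, g)).2.2⟩, h)).1
      (src_arrow ⟨_, (arrow (y, g)).2.2⟩ h).symm

/-- The action `y · g` of the isotropy group on an orbifold chart. -/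
def OrbifoldChart.act {G : TGpd.{u}} {x : G.Obj} (C : G.OrbifoldChart x) (y : C.V)
    (g : G.Isotropy x) : C.V :=
  ⟨G.tgt (C.arrow (y, g)).1, (C.arrow (y, g)).2.2⟩

/-- The fixed point set `V^g` in an orbifold chart. -/
abbrev OrbifoldChart.Fixed {G : TGpd.{u}} {x : G.Obj} (C : G.OrbifoldChart x)
    (g : G.Isotropy x) : Type u :=
  {y : C.V // C.act y g = y}

/-- An orbifold structure `{(V_p, G_p)}` on the orbifold represented by `G`: one orbifold chart at
(an object representing) every point `p`, so that `G_p` is the isotropy group of `pt p`, together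
with a representative of every conjugacy class of every `G_p`. -/
structure OrbifoldAtlas where
  pt : G.OrbitSpace → G.Obj
  pt_eq : ∀ p, Quotient.mk G.orbitSetoid (pt p) = p
  chart : ∀ p, G.OrbifoldChart (pt p)
  rep : ∀ p, ConjClasses (G.Isotropy (pt p)) → G.Isotropy (pt p)
  rep_eq : ∀ p c, ConjClasses.mk (rep p c) = c

namespace OrbifoldAtlas

variable {G : TGpd.{u}} (A : G.OrbifoldAtlas)

/-- The set of points of the twisted sectors: pairs `(p, (g))` of a point `p` of the orbifold and a
conjugacy class `(g)` in `G_p`. -/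
abbrev SectorPoint : Type u := Σ p : G.OrbitSpace, ConjClasses (G.Isotropy (A.pt p))

/-- The disjoint union of the charts `V_p^g` of the twisted sectors over all `(p, (g))`. -/
abbrev SectorObj : Type u := Σ q : A.SectorPoint, (A.chart q.1).Fixed (A.rep q.1 q.2)

/-- The object of `G` underlying a point of a chart of the twisted sectors. -/
def base (y : A.SectorObj) : G.Obj := y.2.1.1

/-- For a point `y` of the chart `V_p^g`, the element `g`, regarded as an arrow `y → y`. -/
def loop (y : A.SectorObj) : G.Arr := ((A.chart y.1.1).arrow (y.2.1, A.rep y.1.1 y.1.2)).1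

theorem src_loop (y : A.SectorObj) : G.src (A.loop y) = A.base y :=
  (A.chart y.1.1).src_arrow _ _

theorem tgt_loop (y : A.SectorObj) : G.tgt (A.loop y) = A.base y :=
  congrArg Subtype.val y.2.2

/-- For `y ∈ V_p^g` and `y' ∈ V_q^h`, the arrow `a` of `G` goes from `y` to `y'` and intertwines
`g` and `h`. -/
def Intertwines (y : A.SectorObj) (a : G.Arr) (y' : A.SectorObj) : Prop :=
  ∃ (hs : G.src a = A.base y) (ht : G.tgt a = A.base y'),
    G.comp (A.loop y) a ((A.tgt_loop y).trans hs.symm) =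
      G.comp a (A.loop y') (ht.trans (A.src_loop y').symm)

variable {A}

theorem intertwines_unit (y : A.SectorObj) : A.Intertwines y (G.unit (A.base y)) y :=
  ⟨G.src_unit _, G.tgt_unit _, (G.comp_unit_of _).trans (G.unit_comp_of _).symm⟩

theorem Intertwines.inv {y y' : A.SectorObj} {a : G.Arr} (h : A.Intertwines y a y') :
    A.Intertwines y' (G.inv a) y := by
  obtain ⟨hs, ht, e⟩ := h
  refine ⟨(G.src_inv a).trans ht, (G.tgt_inv a).trans hs, ?_⟩
  have hc : G.tgt (A.loop y) = G.src a := (A.tgt_loop y).trans hs.symm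
  have h0 : G.tgt (G.inv a) = G.src (G.comp (A.loop y) a hc) := by
    rw [G.tgt_inv, G.src_comp, A.src_loop, hs]
  have h1 : G.comp (G.inv a) (G.comp (A.loop y) a hc) h0 = A.loop y' := by
    rw [G.comp_congr rfl e]
    exact G.inv_comp_cancel _ _
  have h2 : G.tgt (G.comp (A.loop y) a hc) = G.src (G.inv a) := by
    rw [G.tgt_comp, G.src_inv]
  have h3 : G.comp (G.comp (A.loop y) a hc) (G.inv a) h2 = A.loop y := by
    rw [G.assoc _ _ _ hc (G.src_inv a).symm, G.comp_congr rfl (G.comp_inv a)]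
    exact G.comp_unit_of _
  rw [G.comp_congr h1.symm rfl, G.assoc _ _ _ h0 h2]
  exact G.comp_congr rfl h3 _

theorem Intertwines.composable {x y z : A.SectorObj} {a b : G.Arr} (h : A.Intertwines x a y)
    (h' : A.Intertwines y b z) : G.tgt a = G.src b :=
  h.2.1.trans h'.1.symm

theorem Intertwines.comp {x y z : A.SectorObj} {a b : G.Arr} (h : A.Intertwines x a y)
    (h' : A.Intertwines y b z) : A.Intertwines x (G.comp a b (h.composable h')) z := by
  have hab := h.composable h'
  obtain ⟨hs, ht, e⟩ := h
  obtain ⟨hs', ht', e'⟩ := h'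
  refine ⟨(G.src_comp _ _ _).trans hs, (G.tgt_comp _ _ _).trans ht', ?_⟩
  rw [← G.assoc _ _ _ ((A.tgt_loop x).trans hs.symm) hab, G.comp_congr e rfl,
    G.assoc _ _ _ (ht.trans (A.src_loop y).symm) ((A.tgt_loop y).trans hs'.symm),
    G.comp_congr rfl e']
  exact (G.assoc _ _ _ _ _).symm

variable (A)

/-- An arrow of the twisted sectors from `y ∈ V_p^g` to `y' ∈ V_q^h` is an arrow `a : y → y'` of `G`
that intertwines `g` and `h`. -/
abbrev SectorArr : Type u :=
  {r : A.SectorObj × G.Arr × A.SectorObj // A.Intertwines r.1 r.2.1 r.2.2}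

/-- Composition of arrows of the twisted sectors. -/
def sectorComp (r r' : A.SectorArr) (h : r.1.2.2 = r'.1.1) : A.SectorArr :=
  have hr : A.Intertwines r.1.2.2 r'.1.2.1 r'.1.2.2 := by
    rw [h]
    exact r'.2
  ⟨(r.1.1, G.comp r.1.2.1 r'.1.2.1 (r.2.composable hr), r'.1.2.2), r.2.comp hr⟩

theorem sectorArr_ext {r r' : A.SectorArr} (h1 : r.1.1 = r'.1.1) (h2 : r.1.2.1 = r'.1.2.1)
    (h3 : r.1.2.2 = r'.1.2.2) : r = r' :=
  Subtype.ext (Prod.ext h1 (Prod.ext h2 h3))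

/-- The groupoid of twisted sectors: the orbifold with points `(p, (g))` and charts
`(V_p^g, C(g))`. Its objects are the disjoint union of the `V_p^g` over all `(p, (g))`, its arrows
are the arrows of `G` that intertwine the corresponding group elements; in particular its
restriction to `V_p^g` is the action groupoid of the centralizer `C(g)` on `V_p^g`. -/
def twistedSectors : TGpd.{u} where
  Obj := A.SectorObj
  Arr := A.SectorArr
  src r := r.1.1
  tgt r := r.1.2.2
  unit y := ⟨(y, G.unit (A.base y), y), intertwines_unit y⟩
  inv r := ⟨(r.1.2.2, G.inv r.1.2.1, r.1.1), r.2.inv⟩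
  comp := A.sectorComp
  src_unit _ := rfl
  tgt_unit _ := rfl
  src_inv _ := rfl
  tgt_inv _ := rfl
  src_comp _ _ _ := rfl
  tgt_comp _ _ _ := rfl
  unit_comp r := A.sectorArr_ext rfl (G.unit_comp_of ((G.tgt_unit _).trans r.2.1.symm)) rfl
  comp_unit r := A.sectorArr_ext rfl (G.comp_unit_of (r.2.2.1.trans (G.src_unit _).symm)) rfl
  inv_comp r := A.sectorArr_ext rfl ((G.inv_comp _).trans (congrArg G.unit r.2.2.1)) rfl
  comp_inv r := A.sectorArr_ext rfl ((G.comp_inv _).trans (congrArg G.unit r.2.1)) rfl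
  assoc r r' r'' h h' := by
    obtain ⟨⟨x, a, y⟩, hr⟩ := r
    obtain ⟨⟨y', b, z⟩, hr'⟩ := r'
    obtain ⟨⟨z', c, w⟩, hr''⟩ := r''
    obtain rfl : y = y' := h
    obtain rfl : z = z' := h'
    exact A.sectorArr_ext rfl
      (G.assoc a b c (hr.composable hr') (hr'.composable hr'')) rfl

end OrbifoldAtlas

end Sectors

end TGpd

/-!
A loop that is invariant under all rotations is constant: after rotating by a generic angle every
jump of the loop between two members of the cover is moved away from the jumps of the original, so
that on a fine enough cover only its holonomy survives. Likewise for the arrows between such loops,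
which are then elements conjugating one holonomy into another. Hence the rotation-fixed loop
groupoid is isomorphic to the inertia groupoid, whose objects are the loops of `G`, on which the
arrows of `G` act by conjugation.

A twisted sector `V_p^g` maps to the inertia groupoid by sending `y` to the loop at `y` given by
`g`. Since isotropy groups are discrete, this map is open; its image meets every conjugacy class of
loops, so that it is a Morita morphism.

For the orbifold chart at `x`, properness makes the isotropy group finite and confines all arrows
between points near `x` to neighbourhoods of its elements, where local sections of the source turn
it into a group acting on a neighbourhood of `x`.
-/

namespace TGpd

/-! ### Morita morphisms and isomorphisms -/

theorem isOpenMap_pullback_snd {X Y Z : Type*} [TopologicalSpace X] [TopologicalSpace Y]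
    [TopologicalSpace Z] {f : X → Z} {g : Y → Z} (hf : IsOpenMap f) (hg : Continuous g) :
    IsOpenMap fun p : {p : X × Y // f p.1 = g p.2} => p.1.2 := by
  rintro _ ⟨O, hO, rfl⟩
  refine isOpen_iff_mem_nhds.2 ?_
  rintro _ ⟨⟨⟨x, y⟩, hxy⟩, hxyO, rfl⟩
  obtain ⟨A, hA, B, hB, hAB⟩ := mem_nhds_prod_iff.1 (hO.mem_nhds hxyO)
  have hfA : g ⁻¹' (f '' A) ∈ nhds y :=
    hg.continuousAt.preimage_mem_nhds (hxy ▸ hf.image_mem_nhds hA)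
  filter_upwards [hB, hfA] with y' hy' ⟨x', hx', e⟩
  exact ⟨⟨(x', y'), e⟩, hAB ⟨hx', hy'⟩, rfl⟩

namespace Hom

/-- The fibre product `(H₀ × H₀) ×_{G₀ × G₀} G₁` attached to a morphism `F : H → G`. -/
abbrev Square {H : TGpd.{v}} {G : TGpd.{u}} (F : Hom H G) : Type max u v :=
  {p : (H.Obj × H.Obj) × G.Arr // G.src p.2 = F.obj p.1.1 ∧ G.tgt p.2 = F.obj p.1.2}

/-- The comparison map of `H₁` with the fibre product; `F` is fully faithful, in the topological
sense, when it is a homeomorphism. -/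
def toSquare {H : TGpd.{v}} {G : TGpd.{u}} (F : Hom H G) (a : H.Arr) : F.Square :=
  ⟨((H.src a, H.tgt a), F.arr a), F.src_arr a, F.tgt_arr a⟩

theorem continuous_toSquare {H : TGpd.{v}} {G : TGpd.{u}} [H.IsTopological] (F : Hom H G) :
    Continuous F.toSquare :=
  ((IsTopological.continuous_src.prodMk IsTopological.continuous_tgt).prodMk
    F.arr.continuous).subtype_mk _

theorem isMorita_of_isOpenMap_obj {H : TGpd.{v}} {G : TGpd.{u}} [G.IsTopological] {F : Hom H G}
    (hF : IsHomeomorph F.toSquare) (hobj : IsOpenMap F.obj) (hsrc : IsOpenMap G.src)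
    (hsurj : ∀ x, ∃ a y, G.src a = x ∧ G.tgt a = F.obj y) : F.IsMorita where
  cartesian := hF
  surjective x := by
    obtain ⟨a, y, rfl, h⟩ := hsurj x
    exact ⟨⟨(y, a), h.symm⟩, rfl⟩
  isOpenMap := hsrc.comp (isOpenMap_pullback_snd hobj IsTopological.continuous_tgt)

/-- The identity morphism. -/
protected def id (H : TGpd.{u}) : Hom H H where
  obj := ContinuousMap.id _
  arr := ContinuousMap.id _
  src_arr _ := rfl
  tgt_arr _ := rfl
  arr_unit _ := rfl
  arr_comp _ _ _ := rfl

theorem isMorita_id {H : TGpd.{u}} [H.IsTopological] (hsrc : IsOpenMap H.src) :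
    (Hom.id H).IsMorita := by
  refine isMorita_of_isOpenMap_obj ?_ IsOpenMap.id hsrc
    fun x => ⟨H.unit x, x, H.src_unit x, H.tgt_unit x⟩
  refine isHomeomorph_iff_exists_inverse.2 ⟨continuous_toSquare _, fun p => p.1.2, fun _ => rfl,
    ?_, by fun_prop⟩
  rintro ⟨⟨⟨x, y⟩, a⟩, hx, hy⟩
  exact Subtype.ext (Prod.ext (Prod.ext hx hy) rfl)

theorem IsMorita.isOpenMap_src {K : TGpd.{v}} {H : TGpd.{u}} {F : Hom K H} (hF : F.IsMorita) :
    IsOpenMap K.src := by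
  let toPullback (p : F.Square) :
      {p : {p : K.Obj × H.Arr // F.obj p.1 = H.tgt p.2} × K.Obj // H.src p.1.1.2 = F.obj p.2} :=
    ⟨(⟨(p.1.1.2, p.1.2), p.2.2.symm⟩, p.1.1.1), p.2.1⟩
  have htoPullback : IsHomeomorph toPullback := by
    refine isHomeomorph_iff_exists_inverse.2 ⟨by fun_prop,
      fun q => ⟨((q.1.2, q.1.1.1.1), q.1.1.1.2), q.2, q.1.1.2.symm⟩,
      fun _ => rfl, fun _ => rfl, by fun_prop⟩
  exact (isOpenMap_pullback_snd hF.isOpenMap F.obj.continuous).comp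
    (htoPullback.comp hF.cartesian).isOpenMap

/-- An isomorphism of groupoids with topologies: a morphism that is a homeomorphism both on objects
and on arrows. -/
structure IsIso {H L : TGpd.{u}} (E : Hom H L) : Prop where
  obj : IsHomeomorph E.obj
  arr : IsHomeomorph E.arr

theorem IsMorita.trans_isIso {K : TGpd.{v}} {H L : TGpd.{u}} {F : Hom K H} (hF : F.IsMorita)
    {E : Hom H L} (hE : E.IsIso) : (F.trans E).IsMorita := by
  let square : F.Square ≃ₜ (F.trans E).Square :=
    ((Homeomorph.refl _).prodCongr hE.arr.homeomorph).subtype fun p => by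
      change _ ↔ L.src (E.arr p.2) = E.obj (F.obj p.1.1) ∧ L.tgt (E.arr p.2) = E.obj (F.obj p.1.2)
      simp only [src_arr, tgt_arr, hE.obj.injective.eq_iff]
  let fibre : {p : K.Obj × H.Arr // F.obj p.1 = H.tgt p.2} ≃ₜ
      {p : K.Obj × L.Arr // (F.trans E).obj p.1 = L.tgt p.2} :=
    ((Homeomorph.refl _).prodCongr hE.arr.homeomorph).subtype fun p => by
      change _ ↔ E.obj (F.obj p.1) = L.tgt (E.arr p.2)
      rw [tgt_arr, hE.obj.injective.eq_iff]
  have src_fibre : (fun p => L.src p.1.2) ∘ fibre = E.obj ∘ fun p => H.src p.1.2 :=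
    funext fun p => E.src_arr p.1.2
  refine ⟨square.isHomeomorph.comp hF.cartesian, ?_, ?_⟩
  · exact .of_comp (g := fibre) (src_fibre ▸ hE.obj.surjective.comp hF.surjective)
  · exact .of_comp fibre.continuous fibre.surjective
      (src_fibre ▸ hE.obj.isOpenMap.comp hF.isOpenMap)

theorem IsIso.isTopological {H L : TGpd.{u}} [H.IsTopological] {E : Hom H L} (hE : E.IsIso) :
    L.IsTopological := by
  obtain ⟨-, objInv, -, hobj, hobjInv⟩ := isHomeomorph_iff_exists_inverse.1 hE.obj
  obtain ⟨-, arrInv, -, harr, harrInv⟩ := isHomeomorph_iff_exists_inverse.1 hE.arr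
  refine ⟨?_, ?_, ?_, ?_, ?_⟩
  · exact (E.obj.continuous.comp (IsTopological.continuous_src.comp harrInv)).congr fun a =>
      (E.src_arr _).symm.trans (congrArg L.src (harr a))
  · exact (E.obj.continuous.comp (IsTopological.continuous_tgt.comp harrInv)).congr fun a =>
      (E.tgt_arr _).symm.trans (congrArg L.tgt (harr a))
  · exact (E.arr.continuous.comp (IsTopological.continuous_unit.comp hobjInv)).congr fun x =>
      (E.arr_unit _).trans (congrArg L.unit (hobj x))
  · exact (E.arr.continuous.comp (IsTopological.continuous_inv.comp harrInv)).congr fun a =>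
      (E.arr_inv _).trans (congrArg L.inv (harr a))
  · have hcomposable (p : {p : L.Arr × L.Arr // L.tgt p.1 = L.src p.2}) :
        H.tgt (arrInv p.1.1) = H.src (arrInv p.1.2) :=
      hE.obj.injective (by rw [← E.tgt_arr, ← E.src_arr, harr, harr, p.2])
    exact (E.arr.continuous.comp (H.continuous_comp_of
      (harrInv.comp (continuous_fst.comp continuous_subtype_val))
      (harrInv.comp (continuous_snd.comp continuous_subtype_val)) hcomposable)).congr fun p =>
      (E.arr_comp _ _ _).trans (L.comp_congr (harr _) (harr _) _)

theorem IsMorita.moritaEquivalent {K H L : TGpd.{u}} [K.IsTopological] [H.IsTopological]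
    {F : Hom K H} (hF : F.IsMorita) {E : Hom H L} (hE : E.IsIso) : MoritaEquivalent L K :=
  ⟨hE.isTopological, ‹_›, K, ‹_›, F.trans E, Hom.id K, hF.trans_isIso hE,
    isMorita_id hF.isOpenMap_src⟩

end Hom

end TGpd

namespace TGpd

/-! ### The inertia groupoid -/

section Inertia

variable {G : TGpd.{u}}

theorem comp_left_cancel {a b c : G.Arr} {hb : G.tgt a = G.src b} {hc : G.tgt a = G.src c}
    (h : G.comp a b hb = G.comp a c hc) : b = c :=
  calc b = G.comp (G.inv a) (G.comp a b hb) (by simp) := (G.inv_comp_cancel hb _).symm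
    _ = G.comp (G.inv a) (G.comp a c hc) (by simp) := G.comp_congr rfl h _
    _ = c := G.inv_comp_cancel hc _

theorem comp_inv_cancel_right {a b : G.Arr} (h : G.tgt a = G.src b)
    (h' : G.tgt (G.comp a b h) = G.src (G.inv b)) : G.comp (G.comp a b h) (G.inv b) h' = a := by
  rw [G.assoc a b (G.inv b) h (G.src_inv b).symm, G.comp_congr rfl (G.comp_inv b)]
  exact G.comp_unit_of _

variable (G) in
/-- The loops of a groupoid: the arrows with equal source and target. -/
abbrev Loop : Type u := {g : G.Arr // G.tgt g = G.src g}

namespace Loop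

/-- The arrow `a` conjugates the loop `g` to the loop `h`, in the sense that `g · a = a · h`. -/
def Conj (g : G.Loop) (a : G.Arr) (h : G.Loop) : Prop :=
  ∃ (hs : G.src a = G.src g.1) (ht : G.tgt a = G.src h.1),
    G.comp g.1 a (g.2.trans hs.symm) = G.comp a h.1 ht

theorem conj_unit (g : G.Loop) : g.Conj (G.unit (G.src g.1)) g :=
  ⟨G.src_unit _, G.tgt_unit _, (G.comp_unit_of _).trans (G.unit_comp_of _).symm⟩

namespace Conj

variable {g h k : G.Loop} {a b : G.Arr}

theorem inv (H : g.Conj a h) : h.Conj (G.inv a) g := by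
  obtain ⟨hs, ht, e⟩ := H
  have hga : G.tgt g.1 = G.src a := g.2.trans hs.symm
  have ha : G.tgt h.1 = G.src (G.inv a) := by rw [h.2, G.src_inv, ht]
  refine ⟨(G.src_inv a).trans ht, (G.tgt_inv a).trans hs,
    comp_left_cancel (a := a) (hb := by simp [ht]) (hc := by simp) ?_⟩
  calc G.comp a (G.comp h.1 (G.inv a) ha) (by simp [ht])
      = G.comp (G.comp a h.1 ht) (G.inv a) (by simp [ha]) := (G.assoc _ _ _ ht ha).symm
    _ = G.comp (G.comp g.1 a hga) (G.inv a) (by simp) := G.comp_congr e.symm rfl _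
    _ = g.1 := comp_inv_cancel_right hga _
    _ = G.comp a (G.comp (G.inv a) g.1 (by simp [hs])) (by simp) := (G.comp_inv_cancel _ _).symm

theorem composable (H : g.Conj a h) (H' : h.Conj b k) : G.tgt a = G.src b :=
  H.2.1.trans H'.1.symm

theorem comp (H : g.Conj a h) (H' : h.Conj b k) : g.Conj (G.comp a b (H.composable H')) k := by
  have hab := H.composable H'
  obtain ⟨hs, ht, e⟩ := H
  obtain ⟨hs', ht', e'⟩ := H'
  refine ⟨(G.src_comp _ _ _).trans hs, (G.tgt_comp _ _ _).trans ht', ?_⟩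
  rw [← G.assoc _ _ _ (g.2.trans hs.symm) hab, G.comp_congr e rfl,
    G.assoc _ _ _ ht (h.2.trans hs'.symm), G.comp_congr rfl e']
  exact (G.assoc _ _ _ _ _).symm

end Conj

/-- The conjugate `a⁻¹ · g · a` of a loop `g` by an arrow `a` starting at its base point. -/
def conjBy (g : G.Loop) (a : G.Arr) (h : G.src a = G.src g.1) : G.Loop :=
  ⟨G.comp (G.inv a) (G.comp g.1 a (g.2.trans h.symm)) (by simp [h]), by simp⟩

theorem conj_conjBy (g : G.Loop) (a : G.Arr) (h : G.src a = G.src g.1) :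
    g.Conj a (g.conjBy a h) :=
  ⟨h, by simp [conjBy], (G.comp_inv_cancel _ _).symm⟩

theorem Conj.eq_conjBy {g h : G.Loop} {a : G.Arr} (H : g.Conj a h) : h = g.conjBy a H.1 :=
  Subtype.ext <| comp_left_cancel <| H.2.2.symm.trans (g.conj_conjBy a H.1).2.2

end Loop

variable (G) in
/-- The arrows `g → h` of the inertia groupoid: the arrows of `G` conjugating `g` to `h`. -/
abbrev InertiaArr : Type u := {r : G.Loop × G.Arr × G.Loop // r.1.Conj r.2.1 r.2.2}

theorem inertiaArr_ext {r r' : G.InertiaArr} (h1 : r.1.1 = r'.1.1) (h2 : r.1.2.1 = r'.1.2.1)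
    (h3 : r.1.2.2 = r'.1.2.2) : r = r' :=
  Subtype.ext (Prod.ext h1 (Prod.ext h2 h3))

/-- Composition of arrows of the inertia groupoid. -/
def inertiaComp (r r' : G.InertiaArr) (h : r.1.2.2 = r'.1.1) : G.InertiaArr :=
  have hr : r.1.2.2.Conj r'.1.2.1 r'.1.2.2 := h ▸ r'.2
  ⟨(r.1.1, G.comp r.1.2.1 r'.1.2.1 (r.2.composable hr), r'.1.2.2), r.2.comp hr⟩

variable (G) in
/-- The inertia groupoid: its objects are the loops of `G`, on which the arrows of `G` act by
conjugation. -/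
def inertia : TGpd.{u} where
  Obj := G.Loop
  Arr := G.InertiaArr
  src r := r.1.1
  tgt r := r.1.2.2
  unit g := ⟨(g, G.unit (G.src g.1), g), g.conj_unit⟩
  inv r := ⟨(r.1.2.2, G.inv r.1.2.1, r.1.1), r.2.inv⟩
  comp := inertiaComp
  src_unit _ := rfl
  tgt_unit _ := rfl
  src_inv _ := rfl
  tgt_inv _ := rfl
  src_comp _ _ _ := rfl
  tgt_comp _ _ _ := rfl
  unit_comp r := inertiaArr_ext rfl (G.unit_comp_of ((G.tgt_unit _).trans r.2.1.symm)) rfl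
  comp_unit r := inertiaArr_ext rfl (G.comp_unit_of (r.2.2.1.trans (G.src_unit _).symm)) rfl
  inv_comp r := inertiaArr_ext rfl ((G.inv_comp _).trans (congrArg G.unit r.2.2.1)) rfl
  comp_inv r := inertiaArr_ext rfl ((G.comp_inv _).trans (congrArg G.unit r.2.1)) rfl
  assoc r r' r'' h h' := by
    obtain ⟨⟨x, a, y⟩, hr⟩ := r
    obtain ⟨⟨y', b, z⟩, hr'⟩ := r'
    obtain ⟨⟨z', c, w⟩, hr''⟩ := r''
    obtain rfl : y = y' := h
    obtain rfl : z = z' := h'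
    exact inertiaArr_ext rfl (G.assoc a b c (hr.composable hr') (hr'.composable hr'')) rfl

variable [G.IsTopological]

theorem continuous_src_loop : Continuous fun g : G.Loop => G.src g.1 :=
  IsTopological.continuous_src.comp continuous_subtype_val

instance : G.inertia.IsTopological where
  continuous_src := continuous_fst.comp continuous_subtype_val
  continuous_tgt := continuous_snd.comp (continuous_snd.comp continuous_subtype_val)
  continuous_unit := Continuous.subtype_mk (continuous_id.prodMk
    ((IsTopological.continuous_unit.comp continuous_src_loop).prodMk continuous_id)) _
  continuous_inv := by
    have h : Continuous fun r : G.InertiaArr => r.1 := continuous_subtype_val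
    exact Continuous.subtype_mk (h.snd.snd.prodMk
      ((IsTopological.continuous_inv.comp h.snd.fst).prodMk h.fst)) _
  continuous_comp := by
    have h : Continuous fun p : {p : G.InertiaArr × G.InertiaArr // p.1.1.2.2 = p.2.1.1} =>
      (p.1.1.1, p.1.2.1) := by fun_prop
    exact Continuous.subtype_mk (h.fst.fst.prodMk ((G.continuous_comp_of h.fst.snd.fst
      h.snd.snd.fst _).prodMk h.snd.snd.snd)) _

variable (G) in
/-- An arrow of the inertia groupoid amounts to a conjugating arrow together with its source. -/
def inertiaArrHomeo : {p : G.Arr × G.Loop // G.src p.1 = G.src p.2.1} ≃ₜ G.InertiaArr where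
  toFun p := ⟨(p.1.2, p.1.1, p.1.2.conjBy p.1.1 p.2), p.1.2.conj_conjBy _ p.2⟩
  invFun r := ⟨(r.1.2.1, r.1.1), r.2.1⟩
  left_inv _ := rfl
  right_inv r := inertiaArr_ext rfl rfl r.2.eq_conjBy.symm
  continuous_toFun := by
    have h : Continuous fun p : {p : G.Arr × G.Loop // G.src p.1 = G.src p.2.1} => p.1 :=
      continuous_subtype_val
    refine Continuous.subtype_mk (h.snd.prodMk (h.fst.prodMk (Continuous.subtype_mk ?_ _))) _
    exact G.continuous_comp_of (IsTopological.continuous_inv.comp h.fst) (G.continuous_comp_of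
      (continuous_subtype_val.comp h.snd) h.fst _) _
  continuous_invFun := by
    have h : Continuous fun r : G.InertiaArr => r.1 := continuous_subtype_val
    exact (h.snd.fst.prodMk h.fst).subtype_mk _

theorem isOpenMap_inertia_src (hsrc : IsOpenMap G.src) : IsOpenMap G.inertia.src :=
  (isOpenMap_pullback_snd hsrc continuous_src_loop).comp G.inertiaArrHomeo.symm.isOpenMap

end Inertia

/-! ### The twisted sectors and the inertia groupoid -/

namespace OrbifoldChart

variable {G : TGpd.{u}}

theorem act_base {x : G.Obj} (C : G.OrbifoldChart x) (g : G.Isotropy x) :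
    C.act ⟨x, C.mem⟩ g = ⟨x, C.mem⟩ :=
  Subtype.ext ((congrArg G.tgt (C.arrow_base g)).trans g.2.2)

/-- The loop `y → y` of `G` corresponding to a point `y` fixed by `g`. -/
def fixedLoop {x : G.Obj} (C : G.OrbifoldChart x) (g : G.Isotropy x) (y : C.Fixed g) : G.Loop :=
  ⟨(C.arrow (y.1, g)).1, (congrArg Subtype.val y.2).trans (C.src_arrow _ _).symm⟩

theorem continuous_fixedLoop {x : G.Obj} (C : G.OrbifoldChart x) (g : G.Isotropy x) :
    Continuous (C.fixedLoop g) :=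
  Continuous.subtype_mk (by fun_prop) _

theorem isOpenMap_fixedLoop [G.IsTopological] {x : G.Obj} [DiscreteTopology (G.Isotropy x)]
    (C : G.OrbifoldChart x) (g : G.Isotropy x) : IsOpenMap (C.fixedLoop g) := by
  rintro _ ⟨O, hO, rfl⟩
  have hslice : IsOpen (O ×ˢ {g} : Set (C.V × G.Isotropy x)) := hO.prod (isOpen_discrete _)
  have hrestr : IsOpen {a : G.Arr | G.src a ∈ C.V ∧ G.tgt a ∈ C.V} :=
    (C.isOpen.preimage IsTopological.continuous_src).inter
      (C.isOpen.preimage IsTopological.continuous_tgt)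
  have harrows := hrestr.isOpenMap_subtype_val _ (C.arrow.isOpenMap _ hslice)
  convert harrows.preimage (continuous_subtype_val : Continuous fun h : G.Loop => h.1)
  ext h
  constructor
  · rintro ⟨y, hy, rfl⟩
    exact ⟨_, ⟨(y.1, g), ⟨hy, rfl⟩, rfl⟩, rfl⟩
  · rintro ⟨_, ⟨⟨y, _⟩, ⟨hy, rfl⟩, rfl⟩, e : (C.arrow (y, _)).1 = h.1⟩
    have hfix : C.act y _ = y :=
      Subtype.ext ((congrArg G.tgt e).trans (h.2.trans (e ▸ C.src_arrow _ _)))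
    exact ⟨⟨y, hfix⟩, hy, Subtype.ext e⟩

end OrbifoldChart

namespace OrbifoldAtlas

variable {G : TGpd.{u}} (A : G.OrbifoldAtlas)

/-- The loop of `G` attached to a point of the twisted sectors. -/
def toLoop (y : A.SectorObj) : G.Loop :=
  (A.chart y.1.1).fixedLoop (A.rep y.1.1 y.1.2) y.2

theorem intertwines_iff {y y' : A.SectorObj} {a : G.Arr} :
    A.Intertwines y a y' ↔ (A.toLoop y).Conj a (A.toLoop y') :=
  ⟨fun ⟨hs, ht, e⟩ => ⟨hs.trans (A.src_loop y).symm, ht.trans (A.src_loop y').symm, e⟩,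
    fun ⟨hs, ht, e⟩ => ⟨hs.trans (A.src_loop y), ht.trans (A.src_loop y'), e⟩⟩

theorem continuous_toLoop : Continuous A.toLoop :=
  continuous_sigma fun q => (A.chart q.1).continuous_fixedLoop (A.rep q.1 q.2)

theorem isOpenMap_toLoop [G.IsTopological] [∀ x, DiscreteTopology (G.Isotropy x)] :
    IsOpenMap A.toLoop :=
  isOpenMap_sigma.2 fun q => (A.chart q.1).isOpenMap_fixedLoop (A.rep q.1 q.2)

theorem continuous_base : Continuous A.base :=
  continuous_sigma fun _ => continuous_subtype_val.comp continuous_subtype_val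

/-- The point of the twisted sectors given by the centre of the chart at `p` and the conjugacy
class `c`. -/
def center (p : G.OrbitSpace) (c : ConjClasses (G.Isotropy (A.pt p))) : A.SectorObj :=
  ⟨⟨p, c⟩, ⟨⟨A.pt p, (A.chart p).mem⟩, (A.chart p).act_base _⟩⟩

theorem toLoop_center (p : G.OrbitSpace) (c : ConjClasses (G.Isotropy (A.pt p))) :
    (A.toLoop (A.center p c)).1 = (A.rep p c).1 :=
  (A.chart p).arrow_base _

theorem exists_conj_toLoop (g : G.Loop) : ∃ a y, g.Conj a (A.toLoop y) := by
  set p : G.OrbitSpace := Quotient.mk _ (G.src g.1)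
  obtain ⟨b, hb, hb'⟩ : ∃ b, G.src b = G.src g.1 ∧ G.tgt b = A.pt p :=
    Quotient.exact (A.pt_eq p).symm
  let k : G.Isotropy (A.pt p) := ⟨(g.conjBy b hb).1, by simp [Loop.conjBy, hb'],
    by simp [Loop.conjBy, hb']⟩
  obtain ⟨c, hc⟩ := isConj_iff.1 (ConjClasses.mk_eq_mk_iff_isConj.1 (A.rep_eq p (.mk k)))
  have hkc : k * c = c * A.rep p (.mk k) := (mul_inv_eq_iff_eq_mul.1 hc).symm
  have hconj : (g.conjBy b hb).Conj c.1 (A.toLoop (A.center p (.mk k))) :=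
    ⟨c.2.1.trans k.2.1.symm, c.2.2.trans (A.src_loop (A.center p _)).symm,
      (congrArg Subtype.val hkc).trans (G.comp_congr rfl (A.toLoop_center p _).symm _)⟩
  exact ⟨_, _, (g.conj_conjBy b hb).comp hconj⟩

variable [G.IsTopological]

instance : A.twistedSectors.IsTopological where
  continuous_src := continuous_fst.comp continuous_subtype_val
  continuous_tgt := continuous_snd.comp (continuous_snd.comp continuous_subtype_val)
  continuous_unit := Continuous.subtype_mk (continuous_id.prodMk
    ((IsTopological.continuous_unit.comp A.continuous_base).prodMk continuous_id)) _
  continuous_inv := by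
    have h : Continuous fun r : A.SectorArr => r.1 := continuous_subtype_val
    exact Continuous.subtype_mk (h.snd.snd.prodMk
      ((IsTopological.continuous_inv.comp h.snd.fst).prodMk h.fst)) _
  continuous_comp := by
    have h : Continuous fun p : {p : A.SectorArr × A.SectorArr // p.1.1.2.2 = p.2.1.1} =>
      (p.1.1.1, p.1.2.1) := by fun_prop
    exact Continuous.subtype_mk (h.fst.fst.prodMk ((G.continuous_comp_of h.fst.snd.fst
      h.snd.snd.fst _).prodMk h.snd.snd.snd)) _

/-- The morphism from the twisted sectors to the inertia groupoid. -/
def toInertia : Hom A.twistedSectors G.inertia where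
  obj := ⟨A.toLoop, A.continuous_toLoop⟩
  arr := ⟨fun r => ⟨(A.toLoop r.1.1, r.1.2.1, A.toLoop r.1.2.2), A.intertwines_iff.1 r.2⟩, by
    have h : Continuous fun r : A.SectorArr => r.1 := continuous_subtype_val
    exact Continuous.subtype_mk ((A.continuous_toLoop.comp h.fst).prodMk
      (h.snd.fst.prodMk (A.continuous_toLoop.comp h.snd.snd))) _⟩
  src_arr _ := rfl
  tgt_arr _ := rfl
  arr_unit y := inertiaArr_ext rfl (congrArg G.unit (A.src_loop y).symm) rfl
  arr_comp _ _ _ := rfl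

theorem isHomeomorph_toSquare_toInertia : IsHomeomorph A.toInertia.toSquare := by
  refine isHomeomorph_iff_exists_inverse.2 ⟨A.toInertia.continuous_toSquare,
    fun p => ⟨(p.1.1.1, p.1.2.1.2.1, p.1.1.2), ?_⟩, fun _ => rfl, ?_, ?_⟩
  · obtain ⟨⟨⟨y, y'⟩, ⟨⟨g, a, h⟩, H⟩⟩, hg, hh⟩ := p
    obtain rfl : g = A.toLoop y := hg
    obtain rfl : h = A.toLoop y' := hh
    exact A.intertwines_iff.2 H
  · rintro ⟨⟨⟨y, y'⟩, r⟩, hg, hh⟩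
    exact Subtype.ext (Prod.ext rfl (inertiaArr_ext hg.symm rfl hh.symm))
  · have h : Continuous fun p : {p : (A.SectorObj × A.SectorObj) × G.InertiaArr //
      p.2.1.1 = A.toLoop p.1.1 ∧ p.2.1.2.2 = A.toLoop p.1.2} => (p.1.1, p.1.2.1) := by fun_prop
    exact Continuous.subtype_mk (h.fst.fst.prodMk (h.snd.snd.fst.prodMk h.fst.snd)) _

theorem isMorita_toInertia [∀ x, DiscreteTopology (G.Isotropy x)] (hsrc : IsOpenMap G.src) :
    A.toInertia.IsMorita := by
  refine Hom.isMorita_of_isOpenMap_obj A.isHomeomorph_toSquare_toInertia A.isOpenMap_toLoop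
    (isOpenMap_inertia_src hsrc) fun g => ?_
  obtain ⟨a, y, H⟩ := A.exists_conj_toLoop g
  exact ⟨⟨(g, a, A.toLoop y), H⟩, y, rfl, rfl⟩

end OrbifoldAtlas

end TGpd

namespace TGpd

/-! ### Existence of orbifold charts -/

section Isotropy

variable {G : TGpd.{u}}

theorem discreteTopology_isotropy (hs : IsLocalHomeomorph G.src) (x : G.Obj) :
    DiscreteTopology (G.Isotropy x) := by
  refine discreteTopology_iff_isOpen_singleton.2 fun g => ?_
  obtain ⟨e, hge, he⟩ := hs g.1
  convert e.open_source.preimage (continuous_subtype_val : Continuous fun k : G.Isotropy x => k.1)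
  ext k
  refine ⟨fun h => ?_, fun hke => Subtype.ext (e.injOn hke hge ?_)⟩
  · obtain rfl : k = g := h
    exact hge
  · rw [← he, k.2.1, g.2.1]

theorem finite_isotropy (hs : IsLocalHomeomorph G.src)
    (hp : IsProperMap fun a : G.Arr => (G.src a, G.tgt a)) (x : G.Obj) :
    Finite (G.Isotropy x) := by
  have := discreteTopology_isotropy hs x
  have hfibre : IsCompact {a : G.Arr | G.src a = x ∧ G.tgt a = x} := by
    simpa only [Set.preimage, Set.mem_singleton_iff, Prod.mk.injEq] using
      hp.isCompact_preimage (isCompact_singleton (x := (x, x)))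
  have : CompactSpace (G.Isotropy x) := isCompact_iff_compactSpace.1 hfibre
  exact finite_of_compact_of_discrete

theorem eventually_comp_mem [G.IsTopological] {a b : G.Arr} (h : G.tgt a = G.src b)
    {O : Set G.Arr} (hO : O ∈ nhds (G.comp a b h)) :
    ∀ᶠ p in nhds (a, b), ∀ h' : G.tgt p.1 = G.src p.2, G.comp p.1 p.2 h' ∈ O := by
  have hcomp := (IsTopological.continuous_comp (G := G)).continuousAt (x := ⟨(a, b), h⟩) hO
  obtain ⟨N, hN, hNO⟩ := mem_nhds_subtype _ _ _ |>.1 hcomp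
  filter_upwards [hN] with p hp h'
  exact hNO (show (⟨p, h'⟩ : {p : G.Arr × G.Arr // G.tgt p.1 = G.src p.2}).1 ∈ N from hp)

end Isotropy

/-- Disjoint open neighbourhoods of the isotropy arrows at `x` on which the source map is an open
embedding. Their local inverses extend every isotropy arrow `g` at `x` to a local section of the
source map, and hence to a germ at `x` of a right action of the isotropy group. -/
structure IsotropySections (G : TGpd.{u}) (x : G.Obj) where
  srcHomeo : G.Isotropy x → OpenPartialHomeomorph G.Arr G.Obj
  coe_srcHomeo : ∀ g, ⇑(srcHomeo g) = G.src
  mem_source : ∀ g, g.1 ∈ (srcHomeo g).source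
  eq_of_mem_source : ∀ {g k a}, a ∈ (srcHomeo g).source → a ∈ (srcHomeo k).source → g = k

variable {G : TGpd.{u}} {x : G.Obj}

theorem nonempty_isotropySections [T2Space G.Arr] [Finite (G.Isotropy x)]
    (hs : IsLocalHomeomorph G.src) : Nonempty (G.IsotropySections x) := by
  choose e hmem he using fun g : G.Isotropy x => hs g.1
  obtain ⟨D, hD, hdisj⟩ := (Set.finite_range (Subtype.val : G.Isotropy x → G.Arr)).t2_separation
  have hsource (g : G.Isotropy x) :
      ((e g).restrOpen (D g.1) (hD g.1).2).source = (e g).source ∩ D g.1 :=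
    (e g).restrOpen_source _ _
  refine ⟨⟨fun g => (e g).restrOpen (D g.1) (hD g.1).2, fun g => (he g).symm,
    fun g => hsource g ▸ ⟨hmem g, (hD g.1).1⟩, fun {g k a} hg hk => ?_⟩⟩
  rw [hsource] at hg hk
  exact Subtype.ext (hdisj.elim_set ⟨g, rfl⟩ ⟨k, rfl⟩ a hg.2 hk.2)

namespace IsotropySections

variable (S : G.IsotropySections x)

/-- The local section of the source map through the isotropy arrow `g`. -/
def sec (g : G.Isotropy x) (y : G.Obj) : G.Arr := (S.srcHomeo g).symm y

/-- The germ of the action of the isotropy arrow `g`, defined by the targets of the local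
section. -/
def act (g : G.Isotropy x) (y : G.Obj) : G.Obj := G.tgt (S.sec g y)

theorem src_sec {g : G.Isotropy x} {y : G.Obj} (hy : y ∈ (S.srcHomeo g).target) :
    G.src (S.sec g y) = y :=
  S.coe_srcHomeo g ▸ (S.srcHomeo g).right_inv hy

theorem sec_src {g : G.Isotropy x} {a : G.Arr} (ha : a ∈ (S.srcHomeo g).source) :
    S.sec g (G.src a) = a :=
  S.coe_srcHomeo g ▸ (S.srcHomeo g).left_inv ha

theorem sec_base (g : G.Isotropy x) : S.sec g x = g.1 := by
  simpa only [g.2.1] using S.sec_src (S.mem_source g)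

theorem act_base (g : G.Isotropy x) : S.act g x = x :=
  (congrArg G.tgt (S.sec_base g)).trans g.2.2

theorem base_mem_target (g : G.Isotropy x) : x ∈ (S.srcHomeo g).target := by
  simpa only [S.coe_srcHomeo, g.2.1] using (S.srcHomeo g).map_source (S.mem_source g)

theorem continuousOn_sec (g : G.Isotropy x) : ContinuousOn (S.sec g) (S.srcHomeo g).target :=
  (S.srcHomeo g).continuousOn_symm

theorem tendsto_sec (g : G.Isotropy x) : Filter.Tendsto (S.sec g) (nhds x) (nhds g.1) := by
  simpa only [ContinuousAt, S.sec_base] using (S.continuousOn_sec g).continuousAt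
    ((S.srcHomeo g).open_target.mem_nhds (S.base_mem_target g))

theorem exists_nhds_mem_source (hc : IsClosedMap fun a : G.Arr => (G.src a, G.tgt a)) :
    ∃ N ∈ nhds x, ∀ a, G.src a ∈ N → G.tgt a ∈ N → ∃ g, a ∈ (S.srcHomeo g).source := by
  have hopen : IsOpen (⋃ g, (S.srcHomeo g).source) :=
    isOpen_iUnion fun g => (S.srcHomeo g).open_source
  have hfibre : (fun a : G.Arr => (G.src a, G.tgt a)) ⁻¹' {(x, x)} ⊆
      ⋃ g, (S.srcHomeo g).source := fun a ha =>
    Set.mem_iUnion.2 ⟨⟨a, Prod.ext_iff.1 ha⟩, S.mem_source ⟨a, Prod.ext_iff.1 ha⟩⟩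
  obtain ⟨O, hO, hOsource⟩ := hc.comap_nhds_le (hopen.mem_nhdsSet.2 hfibre)
  rw [nhds_prod_eq, Filter.mem_prod_self_iff] at hO
  obtain ⟨N, hN, hNO⟩ := hO
  exact ⟨N, hN, fun a hs ht => Set.mem_iUnion.1 (hOsource (hNO ⟨hs, ht⟩))⟩

variable [G.IsTopological]

theorem continuousOn_act (g : G.Isotropy x) : ContinuousOn (S.act g) (S.srcHomeo g).target :=
  IsTopological.continuous_tgt.comp_continuousOn (S.continuousOn_sec g)

theorem tendsto_act (g : G.Isotropy x) : Filter.Tendsto (S.act g) (nhds x) (nhds x) := by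
  have h := (IsTopological.continuous_tgt.tendsto g.1).comp (S.tendsto_sec g)
  rwa [g.2.2] at h

theorem eventually_sec_mul (g k : G.Isotropy x) :
    ∀ᶠ y in nhds x, ∀ h : G.tgt (S.sec g y) = G.src (S.sec k (S.act g y)),
      S.sec (g * k) y = G.comp (S.sec g y) (S.sec k (S.act g y)) h := by
  have hcomp : ∀ᶠ p in nhds (g.1, k.1), ∀ h : G.tgt p.1 = G.src p.2,
      G.comp p.1 p.2 h ∈ (S.srcHomeo (g * k)).source :=
    eventually_comp_mem (g.2.2.trans k.2.1.symm)
      ((S.srcHomeo (g * k)).open_source.mem_nhds (S.mem_source (g * k)))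
  have hlim := (S.tendsto_sec g).prodMk_nhds ((S.tendsto_sec k).comp (S.tendsto_act g))
  filter_upwards [hlim.eventually hcomp,
    (S.srcHomeo g).open_target.mem_nhds (S.base_mem_target g)] with y hy hyg h
  simpa only [G.src_comp, S.src_sec hyg, Function.comp_apply] using S.sec_src (hy h)

end IsotropySections

theorem exists_invariant_isConnected_nhds {X Γ : Type*} [TopologicalSpace X]
    [LocallyConnectedSpace X] [Mul Γ] [Finite Γ] {f : Γ → X → X} {x : X} {U : Set X}
    (hU : IsOpen U) (hxU : x ∈ U) (hf : ∀ g, ContinuousOn (f g) U) (hfx : ∀ g, f g x = x)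
    (hmul : ∀ y ∈ U, ∀ g k, f g y ∈ U → f (g * k) y = f k (f g y)) :
    ∃ V ⊆ U, IsOpen V ∧ IsConnected V ∧ x ∈ V ∧ ∀ g, Set.MapsTo (f g) V V := by
  let core : Set X := U ∩ ⋂ g, U ∩ f g ⁻¹' U
  have hcore {y : X} : y ∈ core ↔ y ∈ U ∧ ∀ g, f g y ∈ U :=
    ⟨fun h => ⟨h.1, fun g => (Set.mem_iInter.1 h.2 g).2⟩,
      fun h => ⟨h.1, Set.mem_iInter.2 fun g => ⟨h.1, h.2 g⟩⟩⟩
  have hcore_open : IsOpen core :=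
    hU.inter (isOpen_iInter_of_finite fun g => (hf g).isOpen_inter_preimage hU hU)
  have hxcore : x ∈ core := hcore.2 ⟨hxU, fun g => (hfx g).symm ▸ hxU⟩
  have hcore_maps (g : Γ) : Set.MapsTo (f g) core core := fun y hy => by
    obtain ⟨hyU, hfy⟩ := hcore.1 hy
    exact hcore.2 ⟨hfy g, fun k => hmul y hyU g k (hfy g) ▸ hfy (g * k)⟩
  refine ⟨connectedComponentIn core x, (connectedComponentIn_subset _ _).trans
    Set.inter_subset_left, hcore_open.connectedComponentIn,
    isConnected_connectedComponentIn_iff.2 hxcore, mem_connectedComponentIn hxcore,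
    fun g => Set.mapsTo_iff_image_subset.2 ?_⟩
  have himage := ((hf g).mono Set.inter_subset_left).image_connectedComponentIn_subset hxcore
  rw [hfx] at himage
  exact himage.trans (connectedComponentIn_mono _ (hcore_maps g).image_subset)

namespace IsotropySections

variable (S : G.IsotropySections x)

/-- A domain on which the germ of the action of the isotropy group is an action whose action
groupoid is the restriction of `G`. -/
structure IsChartDomain (V : Set G.Obj) : Prop where
  isOpen : IsOpen V
  isConnected : IsConnected V
  base_mem : x ∈ V
  subset_target : ∀ g, V ⊆ (S.srcHomeo g).target
  mapsTo_act : ∀ g, Set.MapsTo (S.act g) V V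
  sec_mul : ∀ y ∈ V, ∀ g k, ∀ h : G.tgt (S.sec g y) = G.src (S.sec k (S.act g y)),
    S.sec (g * k) y = G.comp (S.sec g y) (S.sec k (S.act g y)) h
  exists_mem_source : ∀ a, G.src a ∈ V → G.tgt a ∈ V → ∃ g, a ∈ (S.srcHomeo g).source

theorem exists_isChartDomain [G.IsTopological] [LocallyConnectedSpace G.Obj]
    [Finite (G.Isotropy x)] (hc : IsClosedMap fun a : G.Arr => (G.src a, G.tgt a)) :
    ∃ V, S.IsChartDomain V := by
  obtain ⟨N, hN, hNsource⟩ := S.exists_nhds_mem_source hc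
  have hgood : ∀ᶠ y in nhds x, y ∈ N ∧ (∀ g, y ∈ (S.srcHomeo g).target) ∧
      ∀ g k, ∀ h : G.tgt (S.sec g y) = G.src (S.sec k (S.act g y)),
        S.sec (g * k) y = G.comp (S.sec g y) (S.sec k (S.act g y)) h :=
    .and hN <| .and
      (Filter.eventually_all.2 fun g => (S.srcHomeo g).open_target.mem_nhds (S.base_mem_target g))
      (Filter.eventually_all.2 fun g => Filter.eventually_all.2 (S.eventually_sec_mul g))
  obtain ⟨U, hUgood, hU, hxU⟩ := mem_nhds_iff.1 hgood
  have htarget (g : G.Isotropy x) : U ⊆ (S.srcHomeo g).target := fun y hy => (hUgood hy).2.1 g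
  have hact_mul (y) (hy : y ∈ U) (g k) (hgy : S.act g y ∈ U) :
      S.act (g * k) y = S.act k (S.act g y) :=
    (congrArg G.tgt ((hUgood hy).2.2 g k (S.src_sec (htarget k hgy)).symm)).trans (G.tgt_comp _ _ _)
  obtain ⟨V, hVU, hV, hVconn, hxV, hVmaps⟩ := exists_invariant_isConnected_nhds hU hxU
    (fun g => (S.continuousOn_act g).mono (htarget g)) S.act_base hact_mul
  exact ⟨V, hV, hVconn, hxV, fun g => hVU.trans (htarget g), hVmaps,
    fun y hy => (hUgood (hVU hy)).2.2,
    fun a hs ht => hNsource a (hUgood (hVU hs)).1 (hUgood (hVU ht)).1⟩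

namespace IsChartDomain

variable {S} {V : Set G.Obj} (hV : S.IsChartDomain V)
include hV

theorem src_sec {y : G.Obj} (hy : y ∈ V) (g : G.Isotropy x) : G.src (S.sec g y) = y :=
  S.src_sec (hV.subset_target g hy)

/-- The comparison map from the action groupoid to the restriction of `G`, on arrows. -/
def arrow (p : V × G.Isotropy x) : {a : G.Arr // G.src a ∈ V ∧ G.tgt a ∈ V} :=
  ⟨S.sec p.2 p.1, (hV.src_sec p.1.2 p.2).symm ▸ p.1.2, hV.mapsTo_act p.2 p.1.2⟩

theorem isHomeomorph_arrow [G.IsTopological] [DiscreteTopology (G.Isotropy x)] :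
    IsHomeomorph hV.arrow := by
  choose index hindex using fun a : {a : G.Arr // G.src a ∈ V ∧ G.tgt a ∈ V} =>
    hV.exists_mem_source a.1 a.2.1 a.2.2
  have hindex_iff {a g} : index a = g ↔ a.1 ∈ (S.srcHomeo g).source :=
    ⟨fun h => h ▸ hindex a, S.eq_of_mem_source (hindex a)⟩
  have hindex_cont : Continuous index := continuous_discrete_rng.2 fun g => by
    simpa only [Set.preimage, Set.mem_singleton_iff, hindex_iff] using
      (S.srcHomeo g).open_source.preimage continuous_subtype_val
  refine isHomeomorph_iff_exists_inverse.2 ⟨?_, fun a => (⟨G.src a.1, a.2.1⟩, index a), ?_, ?_, ?_⟩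
  · exact Continuous.subtype_mk (continuous_prod_of_discrete_right.2 fun g =>
      ((S.continuousOn_sec g).mono (hV.subset_target g)).domRestrict) _
  · exact fun ⟨y, g⟩ => Prod.ext (Subtype.ext (hV.src_sec y.2 g))
      (hindex_iff.2 ((S.srcHomeo g).map_target (hV.subset_target g y.2)))
  · exact fun a => Subtype.ext (S.sec_src (hindex a))
  · exact ((IsTopological.continuous_src.comp continuous_subtype_val).subtype_mk _).prodMk
      hindex_cont

/-- The orbifold chart on a chart domain. -/
noncomputable def orbifoldChart [G.IsTopological] [DiscreteTopology (G.Isotropy x)] :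
    G.OrbifoldChart x where
  V := V
  isOpen := hV.isOpen
  isConnected := hV.isConnected
  mem := hV.base_mem
  arrow := hV.isHomeomorph_arrow.homeomorph
  src_arrow y := hV.src_sec y.2
  arrow_base := S.sec_base
  arrow_mul y g k := hV.sec_mul y y.2 g k _

end IsChartDomain

end IsotropySections

theorem nonempty_orbifoldChart [G.IsTopological] [T2Space G.Arr] [LocallyConnectedSpace G.Obj]
    (hs : IsLocalHomeomorph G.src) (hp : IsProperMap fun a : G.Arr => (G.src a, G.tgt a))
    (x : G.Obj) : Nonempty (G.OrbifoldChart x) := by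
  have := discreteTopology_isotropy hs x
  have := finite_isotropy hs hp x
  obtain ⟨S⟩ := nonempty_isotropySections (x := x) hs
  obtain ⟨V, hV⟩ := S.exists_isChartDomain hp.isClosedMap
  exact ⟨hV.orbifoldChart⟩

theorem nonempty_orbifoldAtlas (h : ∀ x, Nonempty (G.OrbifoldChart x)) :
    Nonempty G.OrbifoldAtlas :=
  ⟨{ pt := Quotient.out
     pt_eq := Quotient.out_eq
     chart := fun _ => (h _).some
     rep := fun _ => Quotient.out
     rep_eq := fun _ => Quotient.out_eq }⟩

end TGpd

namespace CircleCover

/-! ### Covers of the circle and rotation invariant functions -/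

section Gaps

variable (W : CircleCover)

theorem exists_pred (x : ℝ) :
    ∃ a : W.Index, a.val < x ∧ ∀ b : W.Index, b.val < x → b.val ≤ a.val := by
  have hfin : {a : W.Index | a.val ∈ Set.Ico (x - 1) (x - 1 + 1)}.Finite :=
    Set.Finite.of_injOn (fun a _ => a.mem) (fun a ha b hb h =>
      Index.ext ((AddCircle.coe_eq_coe_iff_of_mem_Ico ha hb).1 h)) W.finite
  have hne : {a : W.Index | a.val ∈ Set.Ico (x - 1) (x - 1 + 1)}.Nonempty := by
    obtain ⟨q, hq⟩ := W.nonempty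
    obtain ⟨y, hy, rfl⟩ := (AddCircle.coe_image_Ico_eq (1 : ℝ) (x - 1)).ge (Set.mem_univ q)
    exact ⟨⟨y, hq⟩, hy⟩
  obtain ⟨a, ha, hmax⟩ := Set.exists_max_image _ Index.val hfin hne
  rw [sub_add_cancel] at ha hmax
  refine ⟨a, ha.2, fun b hb => ?_⟩
  obtain h | h := lt_or_ge b.val (x - 1)
  · exact h.le.trans ha.1
  · exact hmax b ⟨h, hb⟩

theorem exists_succ (x : ℝ) :
    ∃ a : W.Index, x < a.val ∧ ∀ b : W.Index, x < b.val → a.val ≤ b.val := by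
  have hfin : {a : W.Index | a.val ∈ Set.Ioc x (x + 1)}.Finite :=
    Set.Finite.of_injOn (fun a _ => a.mem) (fun a ha b hb h =>
      Index.ext ((AddCircle.coe_eq_coe_iff_of_mem_Ioc ha hb).1 h)) W.finite
  have hne : {a : W.Index | a.val ∈ Set.Ioc x (x + 1)}.Nonempty := by
    obtain ⟨q, hq⟩ := W.nonempty
    obtain ⟨y, hy, rfl⟩ := (AddCircle.coe_image_Ioc_eq (1 : ℝ) x).ge (Set.mem_univ q)
    exact ⟨⟨y, hq⟩, hy⟩
  obtain ⟨a, ha, hmin⟩ := Set.exists_min_image _ Index.val hfin hne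
  refine ⟨a, ha.1, fun b hb => ?_⟩
  obtain h | h := lt_or_ge (x + 1) b.val
  · exact ha.2.trans h.le
  · exact hmin b ⟨hb, h⟩

theorem two_mul_ε_le_sub {W : CircleCover} {b c : W.Index} (h : b.val < c.val) :
    2 * W.ε ≤ c.val - b.val := by
  by_contra! hlt
  obtain ⟨a, hab, ha⟩ := W.exists_pred b.val
  obtain ⟨d, hbd, hd⟩ := W.exists_succ b.val
  have hdc := hd c h
  have := W.ε_pos
  have hmem_a : (b.val + d.val) / 2 ∈ W.interval a := by
    refine ⟨by linarith, fun e he hae => ?_⟩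
    have hbe : b.val ≤ e := le_of_not_gt fun heb => (ha ⟨e, he⟩ heb).not_gt hae
    linarith
  have hmem_b : (b.val + d.val) / 2 ∈ W.interval b := by
    refine ⟨by linarith, fun e he hbe => ?_⟩
    have : d.val ≤ e := hd ⟨e, he⟩ hbe
    linarith
  have hmem_d : (b.val + d.val) / 2 ∈ W.interval d :=
    ⟨by linarith, fun _ _ _ => by linarith⟩
  exact Set.eq_empty_iff_forall_notMem.1
    (W.admissible a.val b.val d.val a.mem b.mem d.mem hab hbd) _ ⟨⟨hmem_a, hmem_b⟩, hmem_d⟩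

theorem two_mul_ε_le_abs_sub {W : CircleCover} {b c : W.Index} (h : b.val ≠ c.val) :
    2 * W.ε ≤ |b.val - c.val| := by
  obtain h | h := h.lt_or_gt
  · exact (two_mul_ε_le_sub h).trans (neg_sub b.val c.val ▸ neg_le_abs _)
  · exact (two_mul_ε_le_sub h).trans (le_abs_self _)

theorem mem_interval_floor_self (x : ℝ) : x ∈ W.interval (W.floor x) := by
  have := W.ε_pos
  refine ⟨by linarith [W.floor_le x], fun b hb h => ?_⟩
  have hxb : x < b := lt_of_not_ge fun hbx => (W.le_floor (b := ⟨b, hb⟩) hbx).not_gt h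
  linarith

theorem floor_eq_floor {W : CircleCover} {x y : ℝ} (hyx : y ≤ x)
    (h : ∀ b : W.Index, b.val ≤ x → b.val ≤ y) : W.floor y = W.floor x :=
  (W.floor_eq ((W.floor_le y).trans hyx) fun b hb => W.le_floor (h b hb)).symm

end Gaps

/-- The cover with the same points and a smaller `ε`. -/
def shrink (W : CircleCover) (ε : ℝ) (h0 : 0 < ε) (h : ε ≤ W.ε) : CircleCover where
  pts := W.pts
  finite := W.finite
  nonempty := W.nonempty
  ε := ε
  ε_pos := h0
  admissible a b c ha hb hc hab hbc := by
    have hsub (d : ℝ) : coverInterval W.pts ε d ⊆ coverInterval W.pts W.ε d := fun x hx =>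
      ⟨by linarith [hx.1], fun e he hde => by linarith [hx.2 e he hde]⟩
    exact Set.subset_eq_empty (Set.inter_subset_inter (Set.inter_subset_inter (hsub a) (hsub b))
      (hsub c)) (W.admissible a b c ha hb hc hab hbc)

theorem le_shrink (W : CircleCover) {ε : ℝ} (h0 : 0 < ε) (h : ε ≤ W.ε) : W ≤ W.shrink ε h0 h :=
  ⟨subset_rfl, h⟩

section CommonRefinement

/-- A lift of a point of a cover, as a lift of the same point of a refinement. -/
def Index.ofLE {W W' : CircleCover} (h : W ≤ W') (a : W.Index) : W'.Index := ⟨a.val, h.1 a.mem⟩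

variable {W₁ W₂ W' : CircleCover} {x : ℝ}

theorem two_mul_ε_le_abs_sub_of_disjoint (h₁ : W₁ ≤ W') (h₂ : W₂ ≤ W')
    (hd : Disjoint W₁.pts W₂.pts) (a : W₁.Index) (c : W₂.Index) :
    2 * W'.ε ≤ |a.val - c.val| :=
  two_mul_ε_le_abs_sub (b := a.ofLE h₁) (c := c.ofLE h₂) fun e =>
    Set.disjoint_left.1 hd a.mem (show (a.val : UnitAddCircle) ∈ W₂.pts from
      (show a.val = c.val from e) ▸ c.mem)

theorem exists_index_of_lt_val (h₁ : W₁ ≤ W') (h₂ : W₂ ≤ W') (hd : Disjoint W₁.pts W₂.pts)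
    {a : W₁.Index} (hax : a.val - W'.ε < x) (hxa : x < a.val) :
    ∃ b : W'.Index, x ∈ W'.interval b ∧ W₁.floor b.val = a ∧ W₂.floor b.val = W₂.floor x := by
  have := W'.ε_pos
  refine ⟨a.ofLE h₁, ⟨hax, fun e _ hae => ?_⟩, W₁.floor_val a,
    (floor_eq_floor hxa.le fun c hca => ?_).symm⟩
  · change a.val < e at hae
    linarith
  · change c.val ≤ a.val at hca
    have hgap := two_mul_ε_le_abs_sub_of_disjoint h₁ h₂ hd a c
    rw [abs_of_nonneg (sub_nonneg.2 hca)] at hgap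
    linarith

theorem exists_index_of_val_le (h₁ : W₁ ≤ W') (h₂ : W₂ ≤ W') {a : W₁.Index}
    (ha : W₁.floor x = a) :
    ∃ b : W'.Index, x ∈ W'.interval b ∧ W₁.floor b.val = a ∧ W₂.floor b.val = W₂.floor x :=
  ⟨W'.floor x, W'.mem_interval_floor_self x, (floor_floor h₁ x).trans ha, floor_floor h₂ x⟩

theorem exists_index_of_succ_le (h₁ : W₁ ≤ W') (h₂ : W₂ ≤ W') (hd : Disjoint W₁.pts W₂.pts)
    {a s : W₁.Index} (has : a.val < s.val) (hs : ∀ b : W₁.Index, a.val < b.val → s.val ≤ b.val)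
    (hsx : s.val ≤ x) (hxs : x < s.val + W'.ε) :
    ∃ b : W'.Index, x ∈ W'.interval b ∧ W₁.floor b.val = a ∧ W₂.floor b.val = W₂.floor x := by
  have := W'.ε_pos
  obtain ⟨p, hps, hp⟩ := W'.exists_pred s.val
  have le_of_pred_lt {e : W'.Index} (hpe : p.val < e.val) : s.val ≤ e.val :=
    le_of_not_gt fun hes => (hp e hes).not_gt hpe
  refine ⟨p, ⟨by linarith, fun e he hpe => ?_⟩, W₁.floor_eq (hp (a.ofLE h₁) has) fun b hbp => ?_,
    floor_eq_floor (by linarith) fun c hcx => le_of_not_gt fun hpc => ?_⟩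
  · have hse : s.val ≤ e := le_of_pred_lt (e := ⟨e, he⟩) hpe
    linarith
  · exact le_of_not_gt fun hab => (hbp.trans_lt hps).not_ge (hs b hab)
  · have hsc : s.val ≤ c.val := le_of_pred_lt (e := c.ofLE h₂) hpc
    have hgap := two_mul_ε_le_abs_sub_of_disjoint h₁ h₂ hd s c
    rw [abs_of_nonpos (sub_nonpos.2 hsc)] at hgap
    linarith

theorem exists_index_floor_eq (h₁ : W₁ ≤ W') (h₂ : W₂ ≤ W') (hd : Disjoint W₁.pts W₂.pts)
    {a : W₁.Index} (hx : x ∈ coverInterval W₁.pts W'.ε a.val) :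
    ∃ b : W'.Index, x ∈ W'.interval b ∧ W₁.floor b.val = a ∧ W₂.floor b.val = W₂.floor x := by
  obtain hxa | hax := lt_or_ge x a.val
  · exact exists_index_of_lt_val h₁ h₂ hd hx.1 hxa
  obtain ⟨s, has, hs⟩ := W₁.exists_succ a.val
  obtain hxs | hsx := lt_or_ge x s.val
  · refine exists_index_of_val_le h₁ h₂ (W₁.floor_eq hax fun b hb => ?_)
    exact le_of_not_gt fun hab => (hb.trans_lt hxs).not_ge (hs b hab)
  · exact exists_index_of_succ_le h₁ h₂ hd has hs hsx (hx.2 s.val s.mem has)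

/-- The arrow over `x` of winding number `l` from the interval of the nearest point on the left of
`x` to its translate. -/
noncomputable def baseArr (W : CircleCover) (x : ℝ) (l : ℤ) : W.circle.Arr :=
  ⟨((x, W.floor x, W.floor x), l), W.mem_interval_floor_self x, W.mem_interval_floor_self x⟩

theorem circleArr_ext {W : CircleCover} {r r' : W.circle.Arr} (hx : r.1.1.1 = r'.1.1.1)
    (ha : r.1.1.2.1 = r'.1.1.2.1) (hb : r.1.1.2.2 = r'.1.1.2.2) (hl : r.1.2 = r'.1.2) : r = r' :=
  Subtype.ext (Prod.ext (Prod.ext hx (Prod.ext ha hb)) hl)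

theorem refineHom_baseArr {W W' : CircleCover} (h : W ≤ W') (x : ℝ) (l : ℤ) :
    (refineHom h).arr (W'.baseArr x l) = W.baseArr x l :=
  circleArr_ext rfl (floor_floor h x) (floor_floor h x) rfl

theorem exists_arr_refineHom_eq (h₁ : W₁ ≤ W') (h₂ : W₂ ≤ W') (hd : Disjoint W₁.pts W₂.pts)
    (r : (W₁.shrink W'.ε W'.ε_pos h₁.2).circle.Arr) :
    ∃ r' : W'.circle.Arr, (refineHom h₁).arr r' = (refineHom (W₁.le_shrink W'.ε_pos h₁.2)).arr r ∧
      (refineHom h₂).arr r' = W₂.baseArr r.1.1.1 r.1.2 := by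
  obtain ⟨⟨⟨x, a, b⟩, l⟩, hxa, hxb⟩ := r
  obtain ⟨a', hxa', ha₁, ha₂⟩ := exists_index_floor_eq h₁ h₂ hd (a := ⟨a.val, a.mem⟩) hxa
  obtain ⟨b', hxb', hb₁, hb₂⟩ := exists_index_floor_eq h₁ h₂ hd (a := ⟨b.val, b.mem⟩) hxb
  exact ⟨⟨((x, a', b'), l), hxa', hxb'⟩,
    circleArr_ext rfl (ha₁.trans (W₁.floor_val _).symm) (hb₁.trans (W₁.floor_val _).symm) rfl,
    circleArr_ext rfl ha₂ hb₂ rfl⟩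

end CommonRefinement

section Rotation

theorem unrotate_floor (W : CircleCover) (z x : ℝ) :
    ((W.rotate z).floor x).unrotate = W.floor (x - z) := by
  refine (W.floor_eq (sub_le_sub_right ((W.rotate z).floor_le x) z) fun b hb => ?_).symm
  have hmem : ((b.val + z : ℝ) : UnitAddCircle) ∈ (W.rotate z).pts := by
    simpa only [rotate, Set.mem_ofPred_eq, AddCircle.coe_add, add_sub_cancel_right] using b.mem
  exact le_sub_iff_add_le.2 ((W.rotate z).le_floor (b := ⟨b.val + z, hmem⟩)
    (le_sub_iff_add_le.1 hb))

theorem unrotateHom_baseArr (W : CircleCover) (z x : ℝ) (l : ℤ) :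
    (W.unrotateHom z).arr ((W.rotate z).baseArr x l) = W.baseArr (x - z) l :=
  circleArr_ext rfl (W.unrotate_floor z x) (W.unrotate_floor z x) rfl

theorem exists_disjoint_rotate (W : CircleCover) : ∃ z, Disjoint W.pts (W.rotate z).pts := by
  have : Infinite UnitAddCircle := by
    have : Infinite (Set.Ico (0 : ℝ) (0 + 1)) := Set.infinite_coe_iff.2 (Set.Ico_infinite (by simp))
    exact Infinite.of_injective _ (AddCircle.equivIco (1 : ℝ) 0).symm.injective
  obtain ⟨w, hw⟩ := (W.finite.image2 (fun p q => p - q) W.finite).exists_notMem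
  obtain ⟨z, rfl⟩ := QuotientAddGroup.mk_surjective w
  exact ⟨z, Set.disjoint_left.2 fun p hp hpz => hw ⟨p, hp, _, hpz, sub_sub_cancel p _⟩⟩

/-- Invariance under all rotations, up to refinement of the cover, of a function on the arrows of
the groupoid of a cover. -/
def RotationInvariant {X : Type*} {W : CircleCover} (φ : W.circle.Arr → X) : Prop :=
  ∀ z, ∃ (W' : CircleCover) (hz : W.rotate z ≤ W') (h : W ≤ W'), ∀ r,
    φ ((W.unrotateHom z).arr ((refineHom hz).arr r)) = φ ((refineHom h).arr r)

namespace RotationInvariant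

variable {X : Type*} {W : CircleCover} {φ : W.circle.Arr → X}

theorem apply_baseArr (hφ : RotationInvariant φ) (x : ℝ) (l : ℤ) :
    φ (W.baseArr x l) = φ (W.baseArr 0 l) := by
  obtain ⟨W', hz, h, H⟩ := hφ x
  have hx := H (W'.baseArr x l)
  rw [refineHom_baseArr, refineHom_baseArr, unrotateHom_baseArr, sub_self] at hx
  exact hx.symm

/-- After rotating by a generic angle, every arrow of a suitable refinement is a `baseArr`. -/
theorem exists_refineHom_eq (hφ : RotationInvariant φ) :
    ∃ (W' : CircleCover) (h : W ≤ W'), ∀ r, φ ((refineHom h).arr r) = φ (W.baseArr 0 r.1.2) := by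
  obtain ⟨z, hdisj⟩ := W.exists_disjoint_rotate
  obtain ⟨W', hz, h, H⟩ := hφ z
  refine ⟨W.shrink W'.ε W'.ε_pos h.2, W.le_shrink W'.ε_pos h.2, fun r => ?_⟩
  obtain ⟨r', hr', hr'z⟩ := exists_arr_refineHom_eq h hz hdisj r
  calc φ ((refineHom _).arr r) = φ ((refineHom h).arr r') := by rw [hr']
    _ = φ ((W.unrotateHom z).arr ((refineHom hz).arr r')) := (H r').symm
    _ = φ (W.baseArr (r.1.1.1 - z) r.1.2) := by rw [hr'z, unrotateHom_baseArr]
    _ = φ (W.baseArr 0 r.1.2) := hφ.apply_baseArr _ _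

end RotationInvariant

end Rotation

/-- The cover of the circle with a single point. -/
noncomputable def basic : CircleCover where
  pts := {0}
  finite := Set.finite_singleton _
  nonempty := Set.singleton_nonempty _
  ε := 1 / 2
  ε_pos := by norm_num
  admissible a b c _ hb hc hab hbc := by
    refine Set.eq_empty_of_forall_notMem fun x ⟨⟨hxa, _⟩, hxc⟩ => ?_
    obtain ⟨m, rfl⟩ := (AddCircle.coe_eq_zero_iff (p := (1 : ℝ))).1 hb
    obtain ⟨n, rfl⟩ := (AddCircle.coe_eq_zero_iff (p := (1 : ℝ))).1 hc
    have hxb := hxa.2 _ hb hab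
    have hxc := hxc.1
    simp only [zsmul_eq_mul, mul_one] at hbc hxb hxc
    have hmn : (m : ℝ) + 1 ≤ n := by exact_mod_cast (Int.cast_lt.1 hbc : m < n)
    linarith

end CircleCover

namespace TGpd

/-! ### Constant loops -/

section Power

variable {G : TGpd.{u}}

/-- The pairs of isotropy elements at the source and at the target of `a` that `a` conjugates into
each other, as a subgroup: conjugation by `a` is thus compatible with powers. -/
def intertwiner {x y : G.Obj} (a : G.Arr) (hs : G.src a = x) (ht : G.tgt a = y) :
    Subgroup (G.Isotropy x × G.Isotropy y) where
  carrier := {k | G.comp k.1.1 a (k.1.2.2.trans hs.symm) = G.comp a k.2.1 (ht.trans k.2.2.1.symm)}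
  one_mem' := (G.unit_comp_of _).trans (G.comp_unit_of _).symm
  mul_mem' {k m} hk hm := by
    have hma : G.tgt m.1.1 = G.src a := m.1.2.2.trans hs.symm
    have hak : G.tgt a = G.src k.2.1 := ht.trans k.2.2.1.symm
    calc G.comp (G.comp k.1.1 m.1.1 (k.1.2.2.trans m.1.2.1.symm)) a _
        = G.comp k.1.1 (G.comp m.1.1 a hma) _ := G.assoc _ _ _ _ _
      _ = G.comp k.1.1 (G.comp a m.2.1 _) _ := G.comp_congr rfl hm _
      _ = G.comp (G.comp k.1.1 a _) m.2.1 _ := (G.assoc _ _ _ (k.1.2.2.trans hs.symm) _).symm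
      _ = G.comp (G.comp a k.2.1 hak) m.2.1 _ := G.comp_congr hk rfl _
      _ = G.comp a (G.comp k.2.1 m.2.1 _) _ := G.assoc _ _ _ _ (k.2.2.2.trans m.2.2.1.symm)
  inv_mem' {k} hk := by
    have hka : G.tgt k.1.1 = G.src a := k.1.2.2.trans hs.symm
    have hak : G.tgt a = G.src (G.inv k.2.1) := by simp [ht, k.2.2.2]
    refine comp_left_cancel (a := k.1.1) (hb := ((G.src_comp _ _ _).trans (G.src_inv _)).symm)
      (hc := hka.trans (G.src_comp _ _ _).symm) ?_
    calc G.comp k.1.1 (G.comp (G.inv k.1.1) a _) _ = a := G.comp_inv_cancel _ _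
      _ = G.comp (G.comp a k.2.1 _) (G.inv k.2.1) _ := (comp_inv_cancel_right _ (by simp)).symm
      _ = G.comp (G.comp k.1.1 a hka) (G.inv k.2.1) _ := G.comp_congr hk.symm rfl _
      _ = G.comp k.1.1 (G.comp a (G.inv k.2.1) _) _ := G.assoc _ _ _ _ hak

namespace Loop

/-- A loop as an element of the isotropy group of its base point. -/
def toIsotropy (g : G.Loop) : G.Isotropy (G.src g.1) := ⟨g.1, rfl, g.2⟩

/-- The powers of a loop in the isotropy group of its base point. -/
def pow (g : G.Loop) (l : ℤ) : G.Arr := (g.toIsotropy ^ l).1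

@[simp]
theorem src_pow (g : G.Loop) (l : ℤ) : G.src (g.pow l) = G.src g.1 :=
  (g.toIsotropy ^ l).2.1

@[simp]
theorem tgt_pow (g : G.Loop) (l : ℤ) : G.tgt (g.pow l) = G.src g.1 :=
  (g.toIsotropy ^ l).2.2

theorem pow_zero (g : G.Loop) : g.pow 0 = G.unit (G.src g.1) :=
  congrArg Subtype.val (zpow_zero g.toIsotropy)

theorem pow_one (g : G.Loop) : g.pow 1 = g.1 :=
  congrArg Subtype.val (zpow_one g.toIsotropy)

theorem pow_add (g : G.Loop) (l m : ℤ) :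
    g.pow (l + m) = G.comp (g.pow l) (g.pow m) (by simp) :=
  congrArg Subtype.val (zpow_add g.toIsotropy l m)

theorem pow_neg (g : G.Loop) (l : ℤ) : g.pow (-l) = G.inv (g.pow l) :=
  congrArg Subtype.val (zpow_neg g.toIsotropy l)

theorem pow_isotropy {x : G.Obj} (k : G.Isotropy x) (l : ℤ) :
    pow ⟨k.1, k.2.2.trans k.2.1.symm⟩ l = (k ^ l).1 := by
  obtain ⟨a, rfl, h⟩ := k
  rfl

theorem Conj.pow {g h : G.Loop} {a : G.Arr} (H : g.Conj a h) (l : ℤ) :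
    G.comp (g.pow l) a (by simp [H.1]) = G.comp a (h.pow l) (by simp [H.2.1]) :=
  (intertwiner a H.1 H.2.1).zpow_mem (x := (g.toIsotropy, h.toIsotropy)) H.2.2 l

theorem continuous_pow [G.IsTopological] (l : ℤ) : Continuous fun g : G.Loop => g.pow l := by
  have continuous_natPow (n : ℕ) : Continuous fun g : G.Loop => g.pow n := by
    induction n with
    | zero =>
      exact (IsTopological.continuous_unit.comp continuous_src_loop).congr fun g => g.pow_zero.symm
    | succ n ih =>
      refine (G.continuous_comp_of ih continuous_subtype_val fun g => g.tgt_pow n).congr fun g => ?_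
      rw [Nat.cast_succ, g.pow_add, G.comp_congr rfl g.pow_one]
  obtain ⟨n, rfl | rfl⟩ := l.eq_nat_or_neg
  · exact continuous_natPow n
  · exact (IsTopological.continuous_inv.comp (continuous_natPow n)).congr fun g =>
      (g.pow_neg _).symm

end Loop

end Power

section Constant

variable {G : TGpd.{u}}

/-- The constant loop at the base point of `g`, with holonomy `g`: an arrow of winding number `l`
is sent to the `l`-th power of `g`. -/
def constHom (W : CircleCover) (g : G.Loop) : Hom W.circle G where
  obj := ContinuousMap.const _ (G.src g.1)
  arr := ⟨fun r => g.pow r.1.2,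
    (continuous_of_discreteTopology (f := g.pow)).comp (continuous_snd.comp continuous_subtype_val)⟩
  src_arr _ := g.src_pow _
  tgt_arr _ := g.tgt_pow _
  arr_unit _ := g.pow_zero
  arr_comp _ _ _ := g.pow_add _ _

theorem trans_constHom {W W' : CircleCover} (E : Hom W'.circle W.circle)
    (hE : ∀ r, (E.arr r).1.2 = r.1.2) (g : G.Loop) :
    E.trans (constHom W g) = constHom W' g :=
  Hom.ext' (fun _ => rfl) fun r => congrArg g.pow (hE r)

theorem exists_eq_constHom {W : CircleCover} (F : Hom W.circle G)
    (hF : ∀ r, F.arr r = F.arr (W.baseArr 0 r.1.2)) : ∃ g : G.Loop, F = constHom W g := by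
  let x := G.src (F.arr (W.baseArr 0 0))
  have hobj (p : W.circle.Obj) : F.obj p = x :=
    calc F.obj p = G.src (G.unit (F.obj p)) := (G.src_unit _).symm
      _ = G.src (F.arr (W.circle.unit p)) := congrArg G.src (F.arr_unit p).symm
      _ = x := congrArg G.src (hF (W.circle.unit p))
  let holonomyHom : Multiplicative ℤ →* G.Isotropy x :=
    MonoidHom.mk' (fun l => ⟨F.arr (W.baseArr 0 l.toAdd), (F.src_arr _).trans (hobj _),
      (F.tgt_arr _).trans (hobj _)⟩) fun l m => Subtype.ext (by
        let r := W.baseArr 0 l.toAdd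
        let r' : W.circle.Arr := ⟨(((W.circle.tgt r).1.1, (W.circle.tgt r).1.2,
          (W.circle.tgt r).1.2), m.toAdd), (W.circle.tgt r).2, (W.circle.tgt r).2⟩
        calc F.arr (W.baseArr 0 (l.toAdd + m.toAdd)) = F.arr (W.circle.comp r r' rfl) :=
              (hF (W.circle.comp r r' rfl)).symm
          _ = G.comp (F.arr r) (F.arr r') _ := F.arr_comp r r' rfl
          _ = G.comp (F.arr r) (F.arr (W.baseArr 0 m.toAdd)) _ := G.comp_congr rfl (hF r') _)
  let k := holonomyHom (Multiplicative.ofAdd 1)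
  refine ⟨⟨k.1, k.2.2.trans k.2.1.symm⟩, Hom.ext' (fun p => (hobj p).trans k.2.1.symm) fun r => ?_⟩
  calc F.arr r = (holonomyHom (Multiplicative.ofAdd r.1.2)).1 := hF r
    _ = (k ^ r.1.2).1 := congrArg Subtype.val (holonomyHom.apply_mint _ (.ofAdd r.1.2))
    _ = Loop.pow ⟨k.1, _⟩ r.1.2 := (Loop.pow_isotropy k _).symm

variable [G.IsTopological]

/-- The constant arrow between constant loops. -/
def constArr (W : CircleCover) (r : G.InertiaArr) : MapArr W.circle G :=
  MapArr.ofUnits (constHom W r.1.1) (constHom W r.1.2.2) (fun _ => r.1.2.1) continuous_const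
    (fun _ => r.2.1) (fun _ => r.2.2.1) fun s => r.2.pow s.1.2

theorem constArr_app_unit (W : CircleCover) (r : G.InertiaArr) (p : W.circle.Obj) :
    (constArr W r).app (W.circle.unit p) = r.1.2.1 :=
  MapArr.ofUnits_app_unit _ _ _ _ _ _ _ p

theorem precomp_constArr {W W' : CircleCover} (E : Hom W'.circle W.circle)
    (hE : ∀ r, (E.arr r).1.2 = r.1.2) (r : G.InertiaArr) :
    (constArr W r).precomp E = constArr W' r := by
  refine MapArr.ext_unit (trans_constHom E hE _) (trans_constHom E hE _) fun p => ?_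
  calc (constArr W r).app (E.arr (W'.circle.unit p))
      = (constArr W r).app (W.circle.unit (E.obj p)) := congrArg _ (E.arr_unit p)
    _ = r.1.2.1 := constArr_app_unit W r _
    _ = (constArr W' r).app (W'.circle.unit p) := (constArr_app_unit W' r p).symm

theorem exists_eq_constArr {W : CircleCover} (L : MapArr W.circle G) {g h : G.Loop}
    (hdom : L.dom = constHom W g) (hcod : L.cod = constHom W h)
    (happ : ∀ r, L.app r = L.app (W.baseArr 0 r.1.2)) : ∃ r : G.InertiaArr, L = constArr W r := by
  set a := L.app (W.baseArr 0 0)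
  have app_unit (p : W.circle.Obj) : L.app (W.circle.unit p) = a := happ _
  have dom_arr : L.dom.arr (W.baseArr 0 1) = g.1 := hdom ▸ g.pow_one
  have cod_arr : L.cod.arr (W.baseArr 0 1) = h.1 := hcod ▸ h.pow_one
  have src_a : G.src a = G.src g.1 := (L.src_app _).trans (hdom ▸ rfl)
  have tgt_a : G.tgt a = G.src h.1 := (L.tgt_app _).trans (hcod ▸ rfl)
  have naturality := L.naturality (W.baseArr 0 1)
  rw [G.comp_congr dom_arr (app_unit _), G.comp_congr (app_unit _) cod_arr] at naturality
  refine ⟨⟨(g, a, h), src_a, tgt_a, naturality⟩, MapArr.ext_unit hdom hcod fun p => ?_⟩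
  rw [app_unit, constArr_app_unit]

theorem continuous_constHom (W : CircleCover) : Continuous (constHom (G := G) W) := by
  have continuous_pow : Continuous fun p : G.Loop × ℤ => p.1.pow p.2 :=
    continuous_prod_of_discrete_right.2 Loop.continuous_pow
  refine continuous_induced_rng.2 (Continuous.prodMk ?_ ?_)
  · exact ContinuousMap.continuous_of_continuous_uncurry _ (continuous_src_loop.comp continuous_fst)
  · exact ContinuousMap.continuous_of_continuous_uncurry _ (continuous_pow.comp
      (continuous_fst.prodMk (continuous_snd.comp (continuous_subtype_val.comp continuous_snd))))

theorem continuous_constArr (W : CircleCover) : Continuous (constArr (G := G) W) := by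
  refine continuous_induced_rng.2 (Continuous.prodMk ?_ ?_)
  · exact (continuous_snd.comp (Hom.continuous_pair _ _)).comp
      ((continuous_constHom W).comp (continuous_fst.comp continuous_subtype_val))
  · have continuous_val : Continuous fun p : G.InertiaArr × W.circle.Obj => p.1.1.2.1 := by fun_prop
    exact ContinuousMap.continuous_of_continuous_uncurry _
      (continuous_val.congr fun p => (constArr_app_unit W p.1 p.2).symm)

variable (G)

/-- The morphism from the inertia groupoid to `LG(W)` that sends a loop of `G` to the constant loop
with this holonomy. -/
def constLoops (W : CircleCover) : Hom G.inertia (mapGpd W.circle G) where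
  obj := ⟨constHom W, continuous_constHom W⟩
  arr := ⟨constArr W, continuous_constArr W⟩
  src_arr _ := rfl
  tgt_arr _ := rfl
  arr_unit g := MapArr.ext_unit rfl rfl fun p => (constArr_app_unit W _ p).trans g.pow_zero.symm
  arr_comp r r' h := by
    obtain ⟨⟨x, a, y⟩, hr⟩ := r
    obtain ⟨⟨y', b, z⟩, hr'⟩ := r'
    obtain rfl : y = y' := h
    refine MapArr.ext_unit rfl rfl fun p => (constArr_app_unit W _ p).trans ?_
    exact ((MapArr.mul_app_unit _ _ rfl p).trans
      (G.comp_congr (constArr_app_unit W _ p) (constArr_app_unit W _ p) _)).symm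

end Constant

/-! ### Rotation-invariant loops are constant -/

/-- A morphism with values in the fixed objects and arrows of a family of endomorphisms, as a
morphism to the fixed subgroupoid. -/
def Hom.toFixedGpd {H : TGpd.{v}} {G : TGpd.{u}} {Z : Type*} {T : Z → Hom G G} (F : Hom H G)
    (hobj : ∀ x z, (T z).obj (F.obj x) = F.obj x) (harr : ∀ a z, (T z).arr (F.arr a) = F.arr a) :
    Hom H (G.fixedGpd T) where
  obj := ⟨fun x => ⟨F.obj x, hobj x⟩, F.obj.continuous.subtype_mk _⟩
  arr := ⟨fun a => ⟨F.arr a, harr a⟩, F.arr.continuous.subtype_mk _⟩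
  src_arr a := Subtype.ext (F.src_arr a)
  tgt_arr a := Subtype.ext (F.tgt_arr a)
  arr_unit x := Subtype.ext (F.arr_unit x)
  arr_comp a b h := Subtype.ext (F.arr_comp a b h)

section FixedLoops

variable (G : TGpd.{u}) [G.IsTopological]

open CircleCover (basic refineHom)

theorem mkObj_constHom (W W' : CircleCover) (g : G.Loop) :
    G.loopSystem.mkObj W (constHom W g) = G.loopSystem.mkObj W' (constHom W' g) := by
  obtain ⟨W'', h, h'⟩ := exists_ge_ge W W'
  exact G.loopSystem.mkObj_eq_iff.2 ⟨W'', h, h',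
    (trans_constHom (refineHom h) (fun _ => rfl) g).trans
      (trans_constHom (refineHom h') (fun _ => rfl) g).symm⟩

theorem mkArr_constArr (W W' : CircleCover) (r : G.InertiaArr) :
    G.loopSystem.mkArr W (constArr W r) = G.loopSystem.mkArr W' (constArr W' r) := by
  obtain ⟨W'', h, h'⟩ := exists_ge_ge W W'
  exact G.loopSystem.mkArr_eq_iff.2 ⟨W'', h, h',
    (precomp_constArr (refineHom h) (fun _ => rfl) r).trans
      (precomp_constArr (refineHom h') (fun _ => rfl) r).symm⟩

/-- The morphism from the inertia groupoid to the fixed loops that sends a loop of `G` to the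
constant loop with this holonomy, here represented on the cover with a single point. -/
noncomputable def inertiaToFixedLoops : Hom G.inertia G.fixedLoopGpd :=
  ((G.constLoops basic).trans (G.loopSystem.ι basic)).toFixedGpd
    (fun g z => (congrArg (G.loopSystem.mkObj (basic.rotate z))
      (trans_constHom (basic.unrotateHom z) (fun _ => rfl) g)).trans
        (G.mkObj_constHom (basic.rotate z) basic g))
    (fun r z => (congrArg (G.loopSystem.mkArr (basic.rotate z))
      (precomp_constArr (basic.unrotateHom z) (fun _ => rfl) r)).trans
        (G.mkArr_constArr (basic.rotate z) basic r))

theorem inertiaToFixedLoops_obj_surjective : Function.Surjective G.inertiaToFixedLoops.obj := by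
  rintro ⟨⟨W, F⟩, hF⟩
  change Hom W.circle G at F
  have hinv : CircleCover.RotationInvariant F.arr := fun z => by
    obtain ⟨W', hz, h, e⟩ := G.loopSystem.mkObj_eq_iff.1 (hF z)
    exact ⟨W', hz, h, fun r => congrArg (fun E : Hom W'.circle G => E.arr r) e⟩
  obtain ⟨W', h, harr⟩ := hinv.exists_refineHom_eq
  obtain ⟨g, hg⟩ := exists_eq_constHom ((refineHom h).trans F) fun r => (harr r).trans
    (harr (W'.baseArr 0 r.1.2)).symm
  refine ⟨g, Subtype.ext ?_⟩
  calc G.loopSystem.mkObj basic (constHom basic g)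
      = G.loopSystem.mkObj W' (constHom W' g) := G.mkObj_constHom basic W' g
    _ = G.loopSystem.mkObj W' ((refineHom h).trans F) := congrArg _ hg.symm
    _ = G.loopSystem.mkObj W F := G.loopSystem.mkObj_map W W' h F

theorem inertiaToFixedLoops_arr_surjective : Function.Surjective G.inertiaToFixedLoops.arr := by
  rintro ⟨⟨W, L⟩, hL⟩
  change MapArr W.circle G at L
  have hinv : CircleCover.RotationInvariant fun r => (L.dom.arr r, L.cod.arr r, L.app r) :=
    fun z => by
      obtain ⟨W', hz, h, e⟩ := G.loopSystem.mkArr_eq_iff.1 (hL z)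
      exact ⟨W', hz, h, fun r => congrArg (fun M : MapArr W'.circle G =>
        (M.dom.arr r, M.cod.arr r, M.app r)) e⟩
  obtain ⟨W', h, hval⟩ := hinv.exists_refineHom_eq
  have hbase (r : W'.circle.Arr) := (hval r).trans (hval (W'.baseArr 0 r.1.2)).symm
  obtain ⟨g, hg⟩ := exists_eq_constHom ((refineHom h).trans L.dom) fun r =>
    congrArg (fun p => p.1) (hbase r)
  obtain ⟨g', hg'⟩ := exists_eq_constHom ((refineHom h).trans L.cod) fun r =>
    congrArg (fun p => p.2.1) (hbase r)
  obtain ⟨r, hr⟩ := exists_eq_constArr (L.precomp (refineHom h)) hg hg' fun r =>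
    congrArg (fun p => p.2.2) (hbase r)
  refine ⟨r, Subtype.ext ?_⟩
  calc G.loopSystem.mkArr basic (constArr basic r)
      = G.loopSystem.mkArr W' (constArr W' r) := G.mkArr_constArr basic W' r
    _ = G.loopSystem.mkArr W' (L.precomp (refineHom h)) := congrArg _ hr.symm
    _ = G.loopSystem.mkArr W L := G.loopSystem.mkArr_map W W' h L

/-- The holonomy of a loop at the base point of the circle. -/
noncomputable def holonomy : G.loopGpd.Obj → G.Arr :=
  DirectLimit.lift _ (fun W (F : Hom W.circle G) => F.arr (W.baseArr 0 1)) fun _ _ h F =>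
    congrArg (Hom.arr F) (CircleCover.refineHom_baseArr h 0 1).symm

/-- The value at the base point of the circle of an arrow between loops. -/
noncomputable def baseValue : G.loopGpd.Arr → G.Arr :=
  DirectLimit.lift _ (fun W (L : MapArr W.circle G) => L.app (W.baseArr 0 0)) fun _ _ h L =>
    congrArg (MapArr.app L) (CircleCover.refineHom_baseArr h 0 0).symm

theorem continuous_holonomy : Continuous G.holonomy :=
  continuous_coinduced_dom.2 (continuous_sigma fun W =>
    (continuous_eval_const (W.baseArr 0 1)).comp
      (continuous_snd.comp (Hom.continuous_pair W.circle G)))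

theorem continuous_holonomy_src : Continuous fun a => G.holonomy (G.loopGpd.src a) :=
  continuous_coinduced_dom.2 (continuous_sigma fun W =>
    (continuous_eval_const (W.baseArr 0 1)).comp
      (continuous_fst.comp (MapArr.continuous_pair W.circle G)))

theorem continuous_baseValue : Continuous G.baseValue :=
  continuous_coinduced_dom.2 (continuous_sigma fun W =>
    (continuous_eval_const (W.circle.src (W.baseArr 0 0))).comp
      (continuous_snd.comp (MapArr.continuous_pair W.circle G)))

theorem isIso_inertiaToFixedLoops : G.inertiaToFixedLoops.IsIso where
  obj := by
    have holonomy_comp : (fun x => G.holonomy x.1) ∘ G.inertiaToFixedLoops.obj =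
        fun g : G.Loop => g.1 := funext Loop.pow_one
    refine isHomeomorph_iff_isEmbedding_surjective.2 ⟨.of_comp G.inertiaToFixedLoops.obj.continuous
      (G.continuous_holonomy.comp continuous_subtype_val) ?_, G.inertiaToFixedLoops_obj_surjective⟩
    exact holonomy_comp ▸ Topology.IsEmbedding.subtypeVal
  arr := by
    let values (a : G.fixedLoopGpd.Arr) : G.Arr × G.Arr :=
      (G.baseValue a.1, G.holonomy (G.loopGpd.src a.1))
    have continuous_values : Continuous values :=
      (G.continuous_baseValue.prodMk G.continuous_holonomy_src).comp continuous_subtype_val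
    have values_comp : values ∘ G.inertiaToFixedLoops.arr =
        Prod.map id Subtype.val ∘ Subtype.val ∘ G.inertiaArrHomeo.symm :=
      funext fun r => Prod.ext
        (constArr_app_unit basic r (basic.circle.src (basic.baseArr 0 0))) (Loop.pow_one r.1.1)
    refine isHomeomorph_iff_isEmbedding_surjective.2 ⟨.of_comp G.inertiaToFixedLoops.arr.continuous
      continuous_values ?_, G.inertiaToFixedLoops_arr_surjective⟩
    rw [values_comp]
    exact (Topology.IsEmbedding.id.prodMap .subtypeVal).comp
      (Topology.IsEmbedding.subtypeVal.comp G.inertiaArrHomeo.symm.isEmbedding)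

end FixedLoops

end TGpd

theorem mainTheorem2_general {G : TGpd.{u}} [G.IsTopological] [T2Space G.Arr]
    [LocallyConnectedSpace G.Obj] (hsrc : IsLocalHomeomorph G.src)
    (hproper : IsProperMap fun a : G.Arr => (G.src a, G.tgt a)) :
    Nonempty G.OrbifoldAtlas ∧
      ∀ A : G.OrbifoldAtlas, TGpd.MoritaEquivalent G.fixedLoopGpd A.twistedSectors := by
  have := TGpd.discreteTopology_isotropy hsrc
  exact ⟨TGpd.nonempty_orbifoldAtlas (TGpd.nonempty_orbifoldChart hsrc hproper), fun A =>
    (A.isMorita_toInertia hsrc.isOpenMap).moritaEquivalent G.isIso_inertiaToFixedLoops⟩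

theorem mainTheorem2 (n : ℕ) (G : TGpd.{u}) [G.IsTopological]
    [ChartedSpace (EuclideanSpace ℝ (Fin n)) G.Obj]
    [ChartedSpace (EuclideanSpace ℝ (Fin n)) G.Arr] (hG : G.IsOrbifold n) :
    Nonempty G.OrbifoldAtlas ∧
      ∀ A : G.OrbifoldAtlas, TGpd.MoritaEquivalent G.fixedLoopGpd A.twistedSectors :=
  have := hG.t2_arr
  have := ChartedSpace.locallyConnectedSpace (EuclideanSpace ℝ (Fin n)) G.Obj
  mainTheorem2_general hG.isLocalDiffeomorph_src.isLocalHomeomorph hG.isProperMap
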